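/- Let $m\ge 6$ and let $\underline x,\underline y,\underline z$ be three vector variables in $\mathbb R^m$. All spaces below are spaces of complex-valued polynomials in $(\underline x,\underline y,\underline z)$. For vector variables $u,v$ put $\langle u,\partial_v\rangle=\sum_j u_j\partial_{v_j}$, $\langle\partial_u,\partial_v\rangle=\sum_j\partial_{u_j}\partial_{v_j}$, $\mathbb E_u=\langle u,\partial_u\rangle$, $\Delta_u=\langle\partial_u,\partial_u\rangle$, and $$L=\langle \underline x,\partial_y\rangle-\tfrac12\Delta_z,\qquad R=\langle \underline y,\partial_x\rangle+\tfrac12|\underline z|^2,\qquad \mathcal E=\mathbb E_y-\mathbb E_x+\mathbb E_z+\tfrac m2 .$$ Let $\ker_{1,\alpha}(L)=\{p: Lp=0,\ (\mathbb E_x+\mathbb E_y)p=p,\ \mathcal E p=\alpha p\}$ and $\Pi_L=1+(\mathcal E-2)^{-1}RL$. For $k\in\mathbb Z$ let $\mathcal H_k$ be the space of $k$-homogeneous harmonic polynomials in $\underline z$, and for $u\in\{x,y\}$ let $\mathcal H_{k,1}(\underline z;\underline u)$ be the space of polynomials in $(\underline z,\underline u)$, $k$-homogeneous in $\underline z$ and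 $1$-homogeneous in $\underline u$, that are annihilated by $\Delta_z,\Delta_u,\langle\partial_z,\partial_u\rangle$ and $\langle \underline z,\partial_u\rangle$. Spaces with a negative degree are $\{0\}$. Let $(1)_u\otimes(k)_z$ be the span of the products $u_jh$ with $1\le j\le m$, $h\in\mathcal H_k$. Let $$S_{uz}=\langle \underline u,\partial_z\rangle-(2\mathbb E_u+m-4)^{-1}|\underline u|^2\langle\partial_u,\partial_z\rangle,$$ $$C_{uz}=\langle \underline u,\underline z\rangle-(2\mathbb E_u+m-4)^{-1}|\underline u|^2\langle \underline z,\partial_u\rangle-(2\mathbb E_z+m-4)^{-1}|\underline z|^2\langle \underline u,\partial_z\rangle+(2\mathbb E_u+m-4)^{-1}(2\mathbb E_z+m-4)^{-1}|\underline u|^2|\underline z|^2\langle\partial_u,\partial_z\rangle .$$ The Lie algebra $\mathfrak{so}(m)$ acts through the operators $\sum_{u\in\{x,y,z\}}(u_a\partial_{u_b}-u_b\partial_{u_a})$. Let $a\in\mathbb N=\{0,1,2,\dots\}$ and $\alpha=\frac m2-1+a$. Then $\ker_{1,\alpha}(L)$ is the direct sum of its subspace $K_x$ of elements of degree $1$ in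 $\underline x$ and of the subspace $K_y=\Pi_L\big((1)_y\otimes(a-2)_z\big)$ coming from the polynomials of degree $1$ in $\underline y$. Moreover: (i) $K_x=(1)_x\otimes(a)_z=\mathcal H_{a,1}(\underline z;\underline x)\oplus S_{xz}\mathcal H_{a+1}\oplus C_{xz}\mathcal H_{a-1}$. The maps $S_{xz}$ on $\mathcal H_{a+1}$ and $C_{xz}$ on $\mathcal H_{a-1}$ are injective and $\mathfrak{so}(m)$-equivariant. The second summand is always an irreducible $\mathfrak{so}(m)$-module; the first and third are irreducible if $a\ge1$ and $\{0\}$ if $a=0$. (ii) $(1)_y\otimes(a-2)_z=\mathcal H_{a-2,1}(\underline z;\underline y)\oplus S_{yz}\mathcal H_{a-1}\oplus C_{yz}\mathcal H_{a-3}$, the map $\Pi_L$ is injective and $\mathfrak{so}(m)$-equivariant on this space, and hence $$K_y=\Pi_L\big(\mathcal H_{a-2,1}(\underline z;\underline y)\oplus S_{yz}\mathcal H_{a-1}\oplus C_{yz}\mathcal H_{a-3}\big)$$ is the direct sum of the images of the three summands. The maps $S_{yz}$ on $\mathcal H_{a-1}$ (if $a\ge2$) and $C_{yz}$ on $\mathcal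 H_{a-3}$ are injective and $\mathfrak{so}(m)$-equivariant. The image of the second summand is an irreducible $\mathfrak{so}(m)$-module if $a\ge2$ and $\{0\}$ otherwise; the images of the first and third are irreducible if $a\ge3$ and $\{0\}$ otherwise. -/

import Mathlib

namespace SympMonogenic

open MvPolynomial

/-- Complex-valued polynomials in three vector variables `x, y, z` of `ℝ^m`. The indeterminate
`(u, j)` is the `j`-th coordinate of the vector variable `u`. -/
abbrev Poly (m : ℕ) : Type := MvPolynomial (Fin 3 × Fin m) ℂ

/-- The vector variable `x`. -/
abbrev vx : Fin 3 := 0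

/-- The vector variable `y`. -/
abbrev vy : Fin 3 := 1

/-- The vector variable `z`. -/
abbrev vz : Fin 3 := 2

variable {m : ℕ}

/-- The multiplication operator by a polynomial. -/
noncomputable def mulOp (p : Poly m) : Module.End ℂ (Poly m) := LinearMap.mulLeft ℂ p

/-- The partial derivative with respect to the `j`-th coordinate of `u`. -/
noncomputable def dOp (u : Fin 3) (j : Fin m) : Module.End ℂ (Poly m) :=
  (pderiv (R := ℂ) (u, j)).toLinearMap

/-- Multiplication by `⟨u, v⟩ = ∑ j, u_j v_j`. -/
noncomputable def innerMul (u v : Fin 3) : Module.End ℂ (Poly m) :=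
  mulOp (∑ j : Fin m, X (u, j) * X (v, j))

/-- Multiplication by `|u|²`. -/
noncomputable def normSqMul (u : Fin 3) : Module.End ℂ (Poly m) := innerMul u u

/-- The operator `⟨u, ∂_v⟩ = ∑ j, u_j ∂_{v_j}`. -/
noncomputable def skewOp (u v : Fin 3) : Module.End ℂ (Poly m) :=
  ∑ j : Fin m, mulOp (X (u, j)) * dOp v j

/-- The operator `⟨∂_u, ∂_v⟩ = ∑ j, ∂_{u_j} ∂_{v_j}`. -/
noncomputable def innerD (u v : Fin 3) : Module.End ℂ (Poly m) :=
  ∑ j : Fin m, dOp u j * dOp v j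

/-- The Laplace operator in the vector variable `u`. -/
noncomputable def laplacian (u : Fin 3) : Module.End ℂ (Poly m) := innerD u u

/-- The Euler operator in the vector variable `u`. -/
noncomputable def euler (u : Fin 3) : Module.End ℂ (Poly m) := skewOp u u

/-! ### The algebra generated by `L`, `R` and `𝓔` -/

/-- `L = ⟨x, ∂_y⟩ - (1/2) Δ_z`. -/
noncomputable def opL (m : ℕ) : Module.End ℂ (Poly m) :=
  skewOp vx vy - (1 / 2 : ℂ) • laplacian vz

/-- `R = ⟨y, ∂_x⟩ + (1/2) |z|²`. -/
noncomputable def opR (m : ℕ) : Module.End ℂ (Poly m) :=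
  skewOp vy vx + (1 / 2 : ℂ) • normSqMul vz

/-- `𝓔 = E_y - E_x + E_z + m/2`. -/
noncomputable def opE (m : ℕ) : Module.End ℂ (Poly m) :=
  euler vy - euler vx + euler vz + ((m : ℂ) / 2) • 1

/-- `ker_{k,α}(L)`: the solutions of `L` that are `k`-homogeneous in `(x, y)` and have
`𝓔`-eigenvalue `α`. -/
noncomputable def kerL (m k : ℕ) (α : ℂ) : Submodule ℂ (Poly m) :=
  LinearMap.ker (opL m) ⊓ Module.End.eigenspace (euler vx + euler vy) (k : ℂ) ⊓
    Module.End.eigenspace (opE m) α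

/-- The elements of `ker_{1,α}(L)` that have degree `1` in `x`. -/
noncomputable def kerLx (m : ℕ) (α : ℂ) : Submodule ℂ (Poly m) :=
  kerL m 1 α ⊓ Module.End.eigenspace (euler vx) 1

/-! ### Inverses of operators that act diagonally on monomials -/

/-- The operator that multiplies the monomial with exponent `s` by `c s`. -/
noncomputable def diagOp (c : (Fin 3 × Fin m →₀ ℕ) → ℂ) : Module.End ℂ (Poly m) :=
  (basisMonomials (Fin 3 × Fin m) ℂ).constr ℂ fun s => monomial s (c s)

/-- The degree in the vector variable `u` of the monomial with exponent `s`. -/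
def degOf (u : Fin 3) (s : Fin 3 × Fin m →₀ ℕ) : ℕ := ∑ j : Fin m, s (u, j)

/-- `(2 E_u + m - 4)⁻¹`, see `shiftInv_inverse`. -/
noncomputable def shiftInv (u : Fin 3) : Module.End ℂ (Poly m) :=
  diagOp fun s => (2 * (degOf u s : ℂ) + m - 4)⁻¹

/-- `(𝓔 - 2)⁻¹`, on all `𝓔`-eigenspaces with eigenvalue different from `2`,
see `opEInv_apply`. -/
noncomputable def opEInv (m : ℕ) : Module.End ℂ (Poly m) :=
  diagOp fun s =>
    ((degOf vy s : ℂ) - (degOf vx s : ℂ) + (degOf vz s : ℂ) + (m : ℂ) / 2 - 2)⁻¹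

theorem coeff_diagOp (c : (Fin 3 × Fin m →₀ ℕ) → ℂ) (s : Fin 3 × Fin m →₀ ℕ) (p : Poly m) :
    coeff s (diagOp c p) = c s * coeff s p := by
  induction p using MvPolynomial.induction_on' with
  | monomial t r =>
    have h : (monomial t r : Poly m) = r • basisMonomials (Fin 3 × Fin m) ℂ t := by
      simp [smul_monomial]
    rw [h, map_smul, diagOp, Module.Basis.constr_basis]
    simp only [coe_basisMonomials, smul_monomial, coeff_monomial, smul_eq_mul, mul_one]
    split_ifs with hts
    · rw [hts, mul_comm]
    · simp
  | add p q hp hq => rw [map_add, coeff_add, coeff_add, hp, hq, mul_add]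

theorem coeff_euler (u : Fin 3) (s : Fin 3 × Fin m →₀ ℕ) (p : Poly m) :
    coeff s (euler u p) = (degOf u s : ℂ) * coeff s p := by
  induction p using MvPolynomial.induction_on' with
  | monomial t r =>
    simp only [euler, skewOp, mulOp, dOp, degOf, LinearMap.sum_apply, Module.End.mul_apply,
      LinearMap.mulLeft_apply, Derivation.coeFn_coe, X_mul_pderiv_monomial, coeff_sum,
      coeff_smul, coeff_monomial, Nat.cast_sum, Finset.sum_mul]
    refine Finset.sum_congr rfl fun j _ => ?_
    split_ifs with hts
    · rw [hts, nsmul_eq_mul]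
    · simp
  | add p q hp hq => rw [map_add, coeff_add, coeff_add, hp, hq, mul_add]

theorem coeff_opE (s : Fin 3 × Fin m →₀ ℕ) (p : Poly m) :
    coeff s (opE m p) =
      ((degOf vy s : ℂ) - (degOf vx s : ℂ) + (degOf vz s : ℂ) + (m : ℂ) / 2) * coeff s p := by
  simp only [opE, LinearMap.add_apply, LinearMap.sub_apply, LinearMap.smul_apply,
    Module.End.one_apply, coeff_add, coeff_sub, coeff_smul, coeff_euler, smul_eq_mul]
  ring

theorem shift_ne_zero (hm : 5 ≤ m) (d : ℕ) : (2 * (d : ℂ) + m - 4) ≠ 0 := by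
  obtain ⟨n, rfl⟩ := Nat.exists_eq_add_of_le hm
  have h : (2 * (d : ℂ) + ((5 + n : ℕ) : ℂ) - 4) = ((2 * d + n + 1 : ℕ) : ℂ) := by
    push_cast; ring
  rw [h]
  exact Nat.cast_ne_zero.mpr (by omega)

/-- `shiftInv u` is a two-sided inverse of `2 E_u + m - 4`. -/
theorem shiftInv_inverse (hm : 5 ≤ m) (u : Fin 3) (p : Poly m) :
    shiftInv u ((2 : ℂ) • euler u p + ((m : ℂ) - 4) • p) = p ∧
      (2 : ℂ) • euler u (shiftInv u p) + ((m : ℂ) - 4) • shiftInv u p = p := by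
  constructor <;> ext s <;>
    simp only [shiftInv, coeff_diagOp, coeff_euler, coeff_add, coeff_smul, smul_eq_mul] <;>
    field_simp [shift_ne_zero hm (degOf u s)] <;> ring

/-- On an `𝓔`-eigenvector with eigenvalue `β ≠ 2`, `opEInv` is the division by `𝓔 - 2`. -/
theorem opEInv_apply {β : ℂ} (hβ : β ≠ 2) {p : Poly m} (hp : opE m p = β • p) :
    opEInv m p = (β - 2)⁻¹ • p ∧ opE m (opEInv m p) - (2 : ℂ) • opEInv m p = p := by
  have h : opEInv m p = (β - 2)⁻¹ • p := by
    ext s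
    have hs := congrArg (coeff s) hp
    rw [coeff_opE, coeff_smul, smul_eq_mul] at hs
    rw [opEInv, coeff_diagOp, coeff_smul, smul_eq_mul]
    rcases eq_or_ne (coeff s p) 0 with h0 | h0
    · simp [h0]
    · rw [mul_right_cancel₀ h0 hs]
  refine ⟨h, ?_⟩
  rw [h, map_smul, hp, smul_smul, smul_smul, ← sub_smul]
  have : (β - 2)⁻¹ * β - 2 * (β - 2)⁻¹ = 1 := by
    have := sub_ne_zero.mpr hβ
    field_simp
  rw [this, one_smul]

/-! ### Transvector generators and the extremal projector -/

/-- `S_{uv} = ⟨u, ∂_v⟩ - (2 E_u + m - 4)⁻¹ |u|² ⟨∂_u, ∂_v⟩`. -/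
noncomputable def opS (m : ℕ) (u v : Fin 3) : Module.End ℂ (Poly m) :=
  skewOp u v - shiftInv u * (normSqMul u * innerD u v)

/-- `C_{uv} = ⟨u, v⟩ - (2 E_u + m - 4)⁻¹ |u|² ⟨v, ∂_u⟩ - (2 E_v + m - 4)⁻¹ |v|² ⟨u, ∂_v⟩
  + ((2 E_u + m - 4)(2 E_v + m - 4))⁻¹ |u|² |v|² ⟨∂_u, ∂_v⟩`. -/
noncomputable def opC (m : ℕ) (u v : Fin 3) : Module.End ℂ (Poly m) :=
  innerMul u v - shiftInv u * (normSqMul u * skewOp v u)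
    - shiftInv v * (normSqMul v * skewOp u v)
    + shiftInv u * shiftInv v * (normSqMul u * normSqMul v * innerD u v)

/-- The (truncated) extremal projector `Π_L = 1 + (𝓔 - 2)⁻¹ R L`. -/
noncomputable def projL (m : ℕ) : Module.End ℂ (Poly m) :=
  1 + opEInv m * (opR m * opL m)

/-! ### Spaces of polynomials -/

/-- Polynomials that are homogeneous of degree `d u` in each vector variable `u`
(only the zero polynomial if one of these integers is negative). -/
noncomputable def homog (m : ℕ) (d : Fin 3 → ℤ) : Submodule ℂ (Poly m) :=
  weightedHomogeneousSubmodule ℂ (fun i : Fin 3 × Fin m => (Pi.single i.1 1 : Fin 3 → ℤ)) d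

/-- `H_k`: the harmonic polynomials in `z` that are homogeneous of degree `k`. -/
noncomputable def harm (m : ℕ) (k : ℤ) : Submodule ℂ (Poly m) :=
  homog m (Pi.single vz k) ⊓ LinearMap.ker (laplacian vz)

/-- `H_{k,l}` in the vector variables `(z, u)`: the simplicial harmonics of degree `k` in `z` and
`l` in `u`. -/
noncomputable def simpHarm (m : ℕ) (u : Fin 3) (k l : ℤ) : Submodule ℂ (Poly m) :=
  homog m (Pi.single vz k + Pi.single u l) ⊓ LinearMap.ker (laplacian vz) ⊓
    LinearMap.ker (laplacian u) ⊓ LinearMap.ker (innerD vz u) ⊓ LinearMap.ker (skewOp vz u)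

/-- `(1)_u ⊗ (k)_z`, as a space of polynomials: the span of the products `u_j h` with `h ∈ H_k`. -/
noncomputable def tensorSpace (m : ℕ) (u : Fin 3) (k : ℤ) : Submodule ℂ (Poly m) :=
  Submodule.span ℂ {p | ∃ (j : Fin m) (h : Poly m), h ∈ harm m k ∧ p = X (u, j) * h}

/-- `W` is the internal direct sum of the subspaces `f i`. -/
def IsDirectSum {n : ℕ} (W : Submodule ℂ (Poly m)) (f : Fin n → Submodule ℂ (Poly m)) : Prop :=
  iSupIndep f ∧ ⨆ i, f i = W

/-! ### The action of `so(m)` -/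

/-- The angular momentum operators `x_a ∂_{x_b} - x_b ∂_{x_a} + y_a ∂_{y_b} - y_b ∂_{y_a}
  + z_a ∂_{z_b} - z_b ∂_{z_a}`, which span the image of `so(m)`. -/
noncomputable def rot (a b : Fin m) : Module.End ℂ (Poly m) :=
  ∑ u : Fin 3, (mulOp (X (u, a)) * dOp u b - mulOp (X (u, b)) * dOp u a)

/-- `W` is stable under the action of `so(m)`. -/
def SoInvariant (W : Submodule ℂ (Poly m)) : Prop :=
  ∀ a b : Fin m, ∀ p ∈ W, rot a b p ∈ W

/-- `W` is an irreducible `so(m)`-module. -/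
structure SoIrreducible (W : Submodule ℂ (Poly m)) : Prop where
  ne_bot : W ≠ ⊥
  invariant : SoInvariant W
  eq_bot_or_eq : ∀ U : Submodule ℂ (Poly m), U ≤ W → SoInvariant U → U = ⊥ ∨ U = W

/-- `T` restricts to an isomorphism of `so(m)`-modules from `W` onto its image `T W`. -/
def SoEmbedding (T : Module.End ℂ (Poly m)) (W : Submodule ℂ (Poly m)) : Prop :=
  (∀ p ∈ W, T p = 0 → p = 0) ∧ ∀ a b : Fin m, ∀ p ∈ W, T (rot a b p) = rot a b (T p)

end SympMonogenic

open SympMonogenic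

/-!
An element of the kernel of `L` is a sum `∑ x_j f_j(z) + ∑ y_j g_j(z)`, and `L p = 0` says that the
`g_j` are harmonic and `Δ f_j = 2 g_j`. The part with `g = 0` is `(1)_x ⊗ (a)_z`
(`kerLx_eq_tensorSpace`). On `(1)_y ⊗ (a - 2)_z` the projector `Π_L` adds to a multiple
of `∑ y_j g_j` a multiple of `|z|² ∑ x_j g_j`, which solves `Δ f_j = 2 g_j`
(`projL_of_mem_tensorSpace`, `projL_mem_kerL`). This gives the two parts of the kernel
(`isDirectSum_kerL`).

For `u ∈ {x, y}` a polynomial `p` in `(1)_u ⊗ (k)_z` is split by two invariant operators. The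
divergence `⟨∂_z, ∂_u⟩` vanishes on the image of `S_{uz}` and on simplicial harmonics, and acts as a
nonzero scalar after `C_{uz}`; the contraction `⟨z, ∂_u⟩` vanishes on simplicial harmonics and acts
as a nonzero scalar after `S_{uz}`. Hence both components, and so the direct sum
(`isDirectSum_tensorSpace`) and the injectivity of `S_{uz}` and `C_{uz}`, can be read off.

Since all operators commute with `so(m)`, it remains to see that `H_k` and `H_{k,1}` are
irreducible. The operators of `so(m)` are skew-adjoint for the Fischer inner product, so orthogonal
complements of invariant subspaces are invariant, and it is enough to find a vector that lies in
every nonzero invariant subspace (`soIrreducible_of_forall_mem`). Fix two coordinates `i₀`, `i₁`,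
let `ζ_u = u_{i₀} + i u_{i₁}`, and let `e_j` be the commuting operators of the complexification of
`so(m)` that map `u_j` to `ζ_u` and `ζ_u` to zero. They are locally nilpotent, so every nonzero
invariant subspace contains a nonzero vector that is annihilated by all `e_j`
(`SoInvariant.exists_raise_eq_zero`). If `p` is such a vector, the equations `e_j p = 0` combine
with the Laplace and Euler equations to show that the derivatives of `p` along the conjugates of
the `ζ_u` are eigenvectors of an Euler operator with an eigenvalue above their degree, hence zero
(`isoDer_eq_zero_of_mem_harm`, `isoDer_eq_zero_of_mem_simpHarm`). What is left is `ζ_z^k` in the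
case of `H_k`, and in the case of `H_{k,1}` the span of the vectors `ζ_z^{k-1} (ζ_z u_j - ζ_u
z_j)` (`exists_eq_sum_hwVec`), on which the rotations of the remaining `m - 2` coordinates act
irreducibly.
-/

namespace SympMonogenic

open MvPolynomial

variable {m : ℕ}

/-! ### The operators in terms of partial derivatives -/

theorem skewOp_apply (u v : Fin 3) (p : Poly m) :
    skewOp u v p = ∑ j : Fin m, X (u, j) * pderiv (v, j) p := by
  simp [skewOp, mulOp, dOp, LinearMap.sum_apply]

theorem innerD_apply (u v : Fin 3) (p : Poly m) :
    innerD u v p = ∑ j : Fin m, pderiv (u, j) (pderiv (v, j) p) := by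
  simp [innerD, dOp, LinearMap.sum_apply]

theorem innerMul_apply (u v : Fin 3) (p : Poly m) :
    innerMul u v p = ∑ j : Fin m, X (u, j) * (X (v, j) * p) := by
  simp [innerMul, mulOp, Finset.sum_mul, mul_assoc]

theorem pderiv_comm (i j : Fin 3 × Fin m) (p : Poly m) :
    pderiv i (pderiv j p) = pderiv j (pderiv i p) := by
  ext s
  simp only [coeff_pderiv, Finsupp.add_apply]
  rw [add_right_comm]
  by_cases h : i = j
  · rw [h]
  · simp only [Finsupp.single_eq_of_ne h, Finsupp.single_eq_of_ne (Ne.symm h), add_zero]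
    ring

theorem innerD_comm (u v : Fin 3) (p : Poly m) : innerD u v p = innerD v u p := by
  simp only [innerD_apply]
  exact Finset.sum_congr rfl fun j _ => pderiv_comm _ _ _

/-! ### Homogeneity in each vector variable -/

theorem mem_homog_iff {d : Fin 3 → ℤ} {p : Poly m} :
    p ∈ homog m d ↔ ∀ s, coeff s p ≠ 0 → ∀ u, (degOf u s : ℤ) = d u := by
  have key : ∀ s : Fin 3 × Fin m →₀ ℕ,
      Finsupp.weight (fun i : Fin 3 × Fin m => (Pi.single i.1 1 : Fin 3 → ℤ)) s =
        fun u => (degOf u s : ℤ) := by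
    intro s
    funext u
    rw [Finsupp.weight_apply, Finsupp.sum_fintype _ _ (by simp), Finset.sum_apply,
      Fintype.sum_prod_type, Finset.sum_eq_single u]
    · simp [degOf]
    · intro v _ hv
      simp [Ne.symm hv]
    · simp
  rw [homog, mem_weightedHomogeneousSubmodule, IsWeightedHomogeneous]
  simp only [key, funext_iff]

theorem X_mul_mem_homog {d d' : Fin 3 → ℤ} {p : Poly m} (hp : p ∈ homog m d) (u : Fin 3)
    (j : Fin m) (h : d' = d + Pi.single u 1) : X (u, j) * p ∈ homog m d' := by
  rw [h, add_comm]
  exact (isWeightedHomogeneous_X ℂ _ (u, j)).mul hp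

theorem pderiv_mem_homog {d d' : Fin 3 → ℤ} {p : Poly m} (hp : p ∈ homog m d) (u : Fin 3)
    (j : Fin m) (h : d' + Pi.single u 1 = d) : pderiv (u, j) p ∈ homog m d' :=
  IsWeightedHomogeneous.pderiv (i := (u, j)) hp h

theorem skewOp_mem_homog {d d' : Fin 3 → ℤ} {p : Poly m} (hp : p ∈ homog m d) (u v : Fin 3)
    (h : d' + Pi.single v 1 = d + Pi.single u 1) : skewOp u v p ∈ homog m d' := by
  rw [skewOp_apply]
  exact Submodule.sum_mem _ fun j _ => X_mul_mem_homog
    (pderiv_mem_homog (d' := d - Pi.single v 1) hp v j (by abel)) u j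
    (by rw [eq_sub_of_add_eq h]; abel)

theorem innerD_mem_homog {d d' : Fin 3 → ℤ} {p : Poly m} (hp : p ∈ homog m d) (u v : Fin 3)
    (h : d' + Pi.single u 1 + Pi.single v 1 = d) : innerD u v p ∈ homog m d' := by
  rw [innerD_apply]
  exact Submodule.sum_mem _ fun j _ =>
    pderiv_mem_homog (pderiv_mem_homog hp v j h) u j rfl

theorem innerMul_mem_homog {d d' : Fin 3 → ℤ} {p : Poly m} (hp : p ∈ homog m d) (u v : Fin 3)
    (h : d' = d + Pi.single v 1 + Pi.single u 1) : innerMul u v p ∈ homog m d' := by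
  rw [innerMul_apply]
  exact Submodule.sum_mem _ fun j _ => X_mul_mem_homog (X_mul_mem_homog hp v j rfl) u j h

theorem eq_zero_of_mem_homog {d : Fin 3 → ℤ} {p : Poly m} (hp : p ∈ homog m d) (u : Fin 3)
    (hu : d u < 0) : p = 0 := by
  ext s
  by_contra h
  have := mem_homog_iff.1 hp s h u
  omega

theorem pderiv_eq_zero_of_mem_homog {d : Fin 3 → ℤ} {p : Poly m} (hp : p ∈ homog m d) {u : Fin 3}
    (hu : d u ≤ 0) (j : Fin m) : pderiv (u, j) p = 0 :=
  eq_zero_of_mem_homog (pderiv_mem_homog (d' := d - Pi.single u 1) hp u j (by abel)) u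
    (by simp; omega)

theorem euler_of_mem_homog {d : Fin 3 → ℤ} {p : Poly m} (hp : p ∈ homog m d) (u : Fin 3) :
    euler u p = (d u : ℂ) • p := by
  ext s
  rw [coeff_euler, coeff_smul, smul_eq_mul]
  by_cases h : coeff s p = 0
  · simp [h]
  · rw [← mem_homog_iff.1 hp s h u, Int.cast_natCast]

theorem mem_homog_of_euler {d : Fin 3 → ℤ} {p : Poly m}
    (h : ∀ u, euler u p = (d u : ℂ) • p) : p ∈ homog m d := by
  refine mem_homog_iff.2 fun s hs u => ?_
  have := congrArg (coeff s) (h u)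
  rw [coeff_euler, coeff_smul, smul_eq_mul] at this
  exact_mod_cast mul_right_cancel₀ hs this

theorem diagOp_of_mem_homog {d : Fin 3 → ℤ} {p : Poly m} (hp : p ∈ homog m d)
    (c : (Fin 3 × Fin m →₀ ℕ) → ℂ) (b : ℂ)
    (h : ∀ s, (∀ u, (degOf u s : ℤ) = d u) → c s = b) : diagOp c p = b • p := by
  ext s
  rw [coeff_diagOp, coeff_smul, smul_eq_mul]
  by_cases h0 : coeff s p = 0
  · simp [h0]
  · rw [h s (mem_homog_iff.1 hp s h0)]

theorem shiftInv_of_mem_homog {d : Fin 3 → ℤ} {p : Poly m} (hp : p ∈ homog m d) (u : Fin 3) :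
    shiftInv u p = (2 * (d u : ℂ) + m - 4)⁻¹ • p := by
  refine diagOp_of_mem_homog hp _ _ fun s hs => ?_
  rw [← hs u, Int.cast_natCast]

theorem opEInv_of_mem_homog {d : Fin 3 → ℤ} {p : Poly m} (hp : p ∈ homog m d) :
    opEInv m p = ((d vy : ℂ) - d vx + d vz + (m : ℂ) / 2 - 2)⁻¹ • p := by
  refine diagOp_of_mem_homog hp _ _ fun s hs => ?_
  simp only [← hs, Int.cast_natCast]

theorem finite_of_le_homog {d : Fin 3 → ℤ} {W : Submodule ℂ (Poly m)} (hW : W ≤ homog m d) :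
    FiniteDimensional ℂ W := by
  have h : W ≤ restrictTotalDegree (Fin 3 × Fin m) ℂ (∑ u, (d u).toNat) := by
    refine hW.trans fun p hp => ?_
    rw [mem_restrictTotalDegree, totalDegree]
    refine Finset.sup_le fun s hs => ?_
    rw [Finsupp.sum_fintype _ _ fun _ => rfl, Fintype.sum_prod_type]
    refine Finset.sum_le_sum fun u _ => ?_
    rw [← mem_homog_iff.1 hp s (mem_support_iff.1 hs) u, Int.toNat_natCast, degOf]
  exact Submodule.finiteDimensional_of_le h

/-! ### Commutation rules -/

theorem pderiv_skewOp (u w v : Fin 3) (k : Fin m) (p : Poly m) :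
    pderiv (v, k) (skewOp u w p) =
      (if v = u then pderiv (w, k) p else 0) + skewOp u w (pderiv (v, k) p) := by
  simp only [skewOp_apply, map_sum, pderiv_mul, Finset.sum_add_distrib,
    pderiv_comm (v, k) (w, _), pderiv_X, Pi.single_apply, Prod.mk.injEq]
  congr 1
  by_cases h : v = u
  · simp [h]
  · simp [h, Ne.symm h]

theorem pderiv_innerMul (u w v : Fin 3) (k : Fin m) (p : Poly m) :
    pderiv (v, k) (innerMul u w p) =
      (if v = u then X (w, k) * p else 0) + (if v = w then X (u, k) * p else 0) +
        innerMul u w (pderiv (v, k) p) := by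
  simp only [innerMul_apply, map_sum, pderiv_mul, Finset.sum_add_distrib, mul_add, add_assoc,
    pderiv_X, Pi.single_apply, Prod.mk.injEq]
  congr 1
  · by_cases h : v = u
    · simp [h]
    · simp [h, Ne.symm h]
  · congr 1
    by_cases h : v = w
    · simp [h]
    · simp [h, Ne.symm h]

theorem pderiv_innerD (u w v : Fin 3) (k : Fin m) (p : Poly m) :
    pderiv (v, k) (innerD u w p) = innerD u w (pderiv (v, k) p) := by
  simp only [innerD_apply, map_sum]
  exact Finset.sum_congr rfl fun j _ => by
    rw [pderiv_comm (v, k), pderiv_comm (v, k)]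

theorem skewOp_X_mul (u w v : Fin 3) (k : Fin m) (p : Poly m) :
    skewOp u w (X (v, k) * p) = (if w = v then X (u, k) * p else 0) + X (v, k) * skewOp u w p := by
  simp only [skewOp_apply, pderiv_mul, mul_add, Finset.sum_add_distrib, pderiv_X,
    Pi.single_apply, Prod.mk.injEq]
  congr 1
  · by_cases h : w = v
    · simp [h]
    · simp [h, Ne.symm h]
  · rw [Finset.mul_sum]
    exact Finset.sum_congr rfl fun j _ => by ring

theorem pderiv_X_mul (w v : Fin 3) (j k : Fin m) (p : Poly m) :
    pderiv (w, j) (X (v, k) * p) =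
      (if w = v then if j = k then p else 0 else 0) + X (v, k) * pderiv (w, j) p := by
  rw [pderiv_mul, pderiv_X, Pi.single_apply]
  by_cases h : w = v <;> by_cases h' : j = k <;> simp [h, h', Ne.symm, eq_comm]

theorem innerD_X_mul (u w v : Fin 3) (k : Fin m) (p : Poly m) :
    innerD u w (X (v, k) * p) = (if u = v then pderiv (w, k) p else 0) +
      (if w = v then pderiv (u, k) p else 0) + X (v, k) * innerD u w p := by
  simp only [innerD_apply, pderiv_X_mul, map_add, Finset.sum_add_distrib, apply_ite (pderiv _),
    map_zero, Finset.mul_sum]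
  by_cases h : u = v <;> by_cases h' : w = v <;> simp [h, h', add_assoc]

/-! ### Equivariance -/

/-- The angular momentum operator `rot a b` as a derivation. -/
noncomputable def rotDer (a b : Fin m) : Derivation ℂ (Poly m) (Poly m) :=
  ∑ u : Fin 3, ((X (u, a) : Poly m) • pderiv (u, b) - (X (u, b) : Poly m) • pderiv (u, a))

theorem rot_apply (a b : Fin m) (p : Poly m) :
    rot a b p = ∑ u : Fin 3, (X (u, a) * pderiv (u, b) p - X (u, b) * pderiv (u, a) p) := by
  simp [rot, mulOp, dOp, LinearMap.sum_apply]

theorem rotDer_apply (a b : Fin m) (p : Poly m) : rotDer a b p = rot a b p := by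
  rw [rot_apply, rotDer, Fin.sum_univ_three, Fin.sum_univ_three]
  rfl

theorem rot_mul (a b : Fin m) (p q : Poly m) :
    rot a b (p * q) = rot a b p * q + p * rot a b q := by
  simp only [← rotDer_apply, Derivation.leibniz, smul_eq_mul]
  ring

theorem rot_X (a b : Fin m) (u : Fin 3) (j : Fin m) :
    rot a b (X (u, j)) =
      (if j = b then X (u, a) else 0) - (if j = a then X (u, b) else 0 : Poly m) := by
  rw [rot_apply, Finset.sum_eq_single u]
  · simp [Pi.single_apply, eq_comm]
  · intro v _ hv
    simp [Ne.symm hv]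
  · simp

/-- The partial derivatives with respect to the coordinates of one vector variable transform
under `so(m)` like the coordinates themselves. -/
theorem rot_pderiv (a b : Fin m) (u : Fin 3) (j : Fin m) (p : Poly m) :
    rot a b (pderiv (u, j) p) = pderiv (u, j) (rot a b p) +
      ((if j = b then pderiv (u, a) p else 0) - (if j = a then pderiv (u, b) p else 0)) := by
  have h : ⁅rotDer a b, pderiv (u, j)⁆ =
      ((if j = b then pderiv (u, a) else 0) - (if j = a then pderiv (u, b) else 0) :
        Derivation ℂ (Poly m) (Poly m)) := by
    refine derivation_ext fun ⟨v, k⟩ => ?_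
    rw [Derivation.commutator_apply, rotDer_apply, rotDer_apply, rot_X]
    have h1 : rot a b (pderiv (u, j) (X (v, k) : Poly m)) = 0 := by
      rw [pderiv_X, Pi.single_apply]
      split_ifs <;> simp [← rotDer_apply]
    rw [h1]
    have h2 : ∀ (i l : Fin m), pderiv (u, i) (X (v, l) : Poly m) =
        if v = u then if l = i then 1 else 0 else 0 := by
      intro i l
      rw [pderiv_X, Pi.single_apply]
      by_cases hv : v = u <;> simp [hv]
    have h3 : ((if j = b then pderiv (u, a) else 0) - (if j = a then pderiv (u, b) else 0) :
        Derivation ℂ (Poly m) (Poly m)) (X (v, k)) =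
        (if j = b then pderiv (u, a) (X (v, k)) else 0) -
          (if j = a then pderiv (u, b) (X (v, k)) else 0) := by
      split_ifs <;> simp
    rw [h3]
    simp only [map_sub, apply_ite (pderiv (u, j)), map_zero, h2]
    by_cases hv : v = u
    · simp only [hv, if_true]
      grind
    · simp [hv]
  have h2 := DFunLike.congr_fun h p
  rw [Derivation.commutator_apply, rotDer_apply, rotDer_apply, sub_eq_iff_eq_add'] at h2
  rw [h2]
  split_ifs <;> simp

/-- A sum `∑ j, A j (B j p)` in which both `A` and `B` transform under `so(m)` like the
coordinates of a vector commutes with `so(m)`. -/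
theorem rot_sum_of_vector (A B : Fin m → Poly m →+ Poly m) (a b : Fin m)
    (hA : ∀ j p, rot a b (A j p) = A j (rot a b p) +
      ((if j = b then A a p else 0) - (if j = a then A b p else 0)))
    (hB : ∀ j p, rot a b (B j p) = B j (rot a b p) +
      ((if j = b then B a p else 0) - (if j = a then B b p else 0))) (p : Poly m) :
    rot a b (∑ j, A j (B j p)) = ∑ j, A j (B j (rot a b p)) := by
  simp only [map_sum, hA, hB, map_add, map_sub, Finset.sum_add_distrib, Finset.sum_sub_distrib,
    apply_ite (A _), map_zero, Finset.sum_ite_eq', Finset.mem_univ, if_true]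
  abel

theorem rot_X_mul (a b : Fin m) (u : Fin 3) (j : Fin m) (p : Poly m) :
    rot a b (X (u, j) * p) = X (u, j) * rot a b p +
      ((if j = b then X (u, a) * p else 0) - (if j = a then X (u, b) * p else 0)) := by
  rw [rot_mul, rot_X, add_comm, sub_mul, ite_mul, ite_mul, zero_mul]

theorem rot_skewOp (a b : Fin m) (u v : Fin 3) (p : Poly m) :
    rot a b (skewOp u v p) = skewOp u v (rot a b p) := by
  simp only [skewOp_apply]
  exact rot_sum_of_vector (fun j => AddMonoidHom.mulLeft (X (u, j)))
    (fun j => (pderiv (v, j)).toLinearMap.toAddMonoidHom) a b (fun j p => rot_X_mul a b u j p)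
    (fun j p => rot_pderiv a b v j p) p

theorem rot_innerD (a b : Fin m) (u v : Fin 3) (p : Poly m) :
    rot a b (innerD u v p) = innerD u v (rot a b p) := by
  simp only [innerD_apply]
  exact rot_sum_of_vector (fun j => (pderiv (u, j)).toLinearMap.toAddMonoidHom)
    (fun j => (pderiv (v, j)).toLinearMap.toAddMonoidHom) a b (fun j p => rot_pderiv a b u j p)
    (fun j p => rot_pderiv a b v j p) p

theorem rot_innerMul (a b : Fin m) (u v : Fin 3) (p : Poly m) :
    rot a b (innerMul u v p) = innerMul u v (rot a b p) := by
  simp only [innerMul_apply]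
  exact rot_sum_of_vector (fun j => AddMonoidHom.mulLeft (X (u, j)))
    (fun j => AddMonoidHom.mulLeft (X (v, j))) a b (fun j p => rot_X_mul a b u j p)
    (fun j p => rot_X_mul a b v j p) p

theorem rot_mem_homog {d : Fin 3 → ℤ} {p : Poly m} (hp : p ∈ homog m d) (a b : Fin m) :
    rot a b p ∈ homog m d := by
  refine mem_homog_of_euler fun u => ?_
  rw [euler, ← rot_skewOp, ← euler, euler_of_mem_homog hp, map_smul]

theorem mem_harm_iff {k : ℤ} {p : Poly m} :
    p ∈ harm m k ↔ p ∈ homog m (Pi.single vz k) ∧ innerD vz vz p = 0 := Iff.rfl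

theorem mem_simpHarm_iff {u : Fin 3} {k l : ℤ} {p : Poly m} :
    p ∈ simpHarm m u k l ↔ p ∈ homog m (Pi.single vz k + Pi.single u l) ∧ innerD vz vz p = 0 ∧
      innerD u u p = 0 ∧ innerD vz u p = 0 ∧ skewOp vz u p = 0 := by
  simp only [simpHarm, Submodule.mem_inf, LinearMap.mem_ker, laplacian, and_assoc]

theorem soInvariant_harm (k : ℤ) : SoInvariant (harm m k) := fun a b p hp =>
  mem_harm_iff.2 ⟨rot_mem_homog hp.1 a b, by rw [← rot_innerD, (mem_harm_iff.1 hp).2, map_zero]⟩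

theorem soInvariant_simpHarm (u : Fin 3) (k l : ℤ) : SoInvariant (simpHarm m u k l) := by
  intro a b p hp
  obtain ⟨h1, h2, h3, h4, h5⟩ := mem_simpHarm_iff.1 hp
  refine mem_simpHarm_iff.2 ⟨rot_mem_homog h1 a b, ?_, ?_, ?_, ?_⟩
  · rw [← rot_innerD, h2, map_zero]
  · rw [← rot_innerD, h3, map_zero]
  · rw [← rot_innerD, h4, map_zero]
  · rw [← rot_skewOp, h5, map_zero]

theorem SoIrreducible.map {W : Submodule ℂ (Poly m)} {T : Module.End ℂ (Poly m)}
    (hW : SoIrreducible W) (hT : SoEmbedding T W) : SoIrreducible (W.map T) := by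
  refine ⟨?_, ?_, ?_⟩
  · obtain ⟨p, hp, hp0⟩ := W.ne_bot_iff.1 hW.ne_bot
    exact (Submodule.ne_bot_iff _).2 ⟨T p, ⟨p, hp, rfl⟩, fun h => hp0 (hT.1 p hp h)⟩
  · rintro a b _ ⟨p, hp, rfl⟩
    exact ⟨rot a b p, hW.invariant a b p hp, hT.2 a b p hp⟩
  · intro U hU hUinv
    have hUW : (U.comap T ⊓ W).map T = U := by
      ext q
      constructor
      · rintro ⟨p, hp, rfl⟩
        exact hp.1
      · intro hq
        obtain ⟨p, hp, rfl⟩ := hU hq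
        exact ⟨p, ⟨hq, hp⟩, rfl⟩
    rcases hW.eq_bot_or_eq (U.comap T ⊓ W) inf_le_right fun a b p hp =>
      ⟨by
          change T (rot a b p) ∈ U
          rw [hT.2 a b p hp.2]
          exact hUinv a b _ hp.1,
        hW.invariant a b p hp.2⟩ with h | h
    · left
      rw [← hUW, h, Submodule.map_bot]
    · right
      rw [← hUW, h]

/-! ### The Fischer inner product and complete reducibility -/

/-- The product of the factorials of the exponents, the squared Fischer norm of a monomial. -/
noncomputable def fischerWeight (s : Fin 3 × Fin m →₀ ℕ) : ℂ := ∏ i, ((s i).factorial : ℂ)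

theorem fischerWeight_add_single (s : Fin 3 × Fin m →₀ ℕ) (i : Fin 3 × Fin m) :
    fischerWeight (s + Finsupp.single i 1) = (s i + 1) * fischerWeight s := by
  simp only [fischerWeight]
  rw [← Finset.mul_prod_erase _ _ (Finset.mem_univ i),
    ← Finset.mul_prod_erase _ (fun j => ((s j).factorial : ℂ)) (Finset.mem_univ i), ← mul_assoc]
  congr 1
  · simp [Nat.factorial_succ]
  · refine Finset.prod_congr rfl fun j hj => ?_
    simp [Finset.ne_of_mem_erase hj]

/-- The Fischer inner product `∑ s, s! conj(p_s) q_s` of two polynomials. -/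
noncomputable def fischer (p q : Poly m) : ℂ :=
  ∑ s ∈ p.support, fischerWeight s * (starRingEnd ℂ (coeff s p) * coeff s q)

theorem fischer_eq_sum {T : Finset (Fin 3 × Fin m →₀ ℕ)} {p : Poly m} (h : p.support ⊆ T)
    (q : Poly m) :
    fischer p q = ∑ s ∈ T, fischerWeight s * (starRingEnd ℂ (coeff s p) * coeff s q) :=
  Finset.sum_subset h fun s _ hs => by simp [notMem_support_iff.1 hs]

theorem fischer_add_left (p p' q : Poly m) : fischer (p + p') q = fischer p q + fischer p' q := by
  classical
  rw [fischer_eq_sum (T := p.support ∪ p'.support) support_add,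
    fischer_eq_sum (T := p.support ∪ p'.support) Finset.subset_union_left,
    fischer_eq_sum (T := p.support ∪ p'.support) Finset.subset_union_right,
    ← Finset.sum_add_distrib]
  refine Finset.sum_congr rfl fun s _ => ?_
  rw [coeff_add, map_add]
  ring

theorem fischer_smul_left (c : ℂ) (p q : Poly m) :
    fischer (c • p) q = starRingEnd ℂ c * fischer p q := by
  rw [fischer_eq_sum (T := p.support) support_smul, fischer, Finset.mul_sum]
  refine Finset.sum_congr rfl fun s _ => ?_
  rw [coeff_smul, smul_eq_mul, map_mul]
  ring

theorem fischer_conj_symm (p q : Poly m) : starRingEnd ℂ (fischer q p) = fischer p q := by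
  classical
  rw [fischer_eq_sum (T := p.support ∪ q.support) Finset.subset_union_left,
    fischer_eq_sum (T := p.support ∪ q.support) Finset.subset_union_right, map_sum]
  refine Finset.sum_congr rfl fun s _ => ?_
  simp only [fischerWeight, map_mul, map_prod, map_natCast, Complex.conj_conj]
  ring

theorem fischer_self (p : Poly m) :
    fischer p p = ((∑ s ∈ p.support,
      (∏ i, ((s i).factorial : ℝ)) * Complex.normSq (coeff s p) : ℝ) : ℂ) := by
  rw [fischer, Complex.ofReal_sum]
  refine Finset.sum_congr rfl fun s _ => ?_
  rw [mul_comm (starRingEnd ℂ _), Complex.mul_conj, fischerWeight]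
  push_cast
  rfl

/-- The Fischer inner product as an inner product space structure. -/
@[reducible]
noncomputable def fischerCore (m : ℕ) : InnerProductSpace.Core ℂ (Poly m) where
  inner := fischer
  conj_inner_symm := fischer_conj_symm
  re_inner_nonneg p := by
    change 0 ≤ (fischer p p).re
    rw [fischer_self, Complex.ofReal_re]
    exact Finset.sum_nonneg fun s _ => mul_nonneg (Finset.prod_nonneg fun i _ => by positivity)
      (Complex.normSq_nonneg _)
  add_left := fischer_add_left
  smul_left p q c := fischer_smul_left c p q
  definite p h := by
    change fischer p p = 0 at h
    rw [fischer_self, Complex.ofReal_eq_zero, Finset.sum_eq_zero_iff_of_nonneg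
      (fun s _ => mul_nonneg (Finset.prod_nonneg fun i _ => by positivity)
        (Complex.normSq_nonneg _))] at h
    by_contra hp
    obtain ⟨s, hs⟩ := Finset.nonempty_iff_ne_empty.2 (mt support_eq_empty.1 hp)
    refine (mul_ne_zero ?_ ?_) (h s hs)
    · exact Finset.prod_ne_zero_iff.2 fun i _ => by positivity
    · exact Complex.normSq_eq_zero.not.2 (mem_support_iff.1 hs)

theorem fischer_add_right (p q q' : Poly m) : fischer p (q + q') = fischer p q + fischer p q' := by
  rw [← fischer_conj_symm, fischer_add_left, map_add, fischer_conj_symm, fischer_conj_symm]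

theorem fischer_sub_left (p p' q : Poly m) : fischer (p - p') q = fischer p q - fischer p' q := by
  rw [eq_sub_iff_add_eq, ← fischer_add_left, sub_add_cancel]

theorem fischer_sub_right (p q q' : Poly m) : fischer p (q - q') = fischer p q - fischer p q' := by
  rw [eq_sub_iff_add_eq, ← fischer_add_right, sub_add_cancel]

theorem fischer_monomial (s : Fin 3 × Fin m →₀ ℕ) (c : ℂ) (q : Poly m) :
    fischer (monomial s c) q = fischerWeight s * (starRingEnd ℂ c * coeff s q) := by
  rw [fischer_eq_sum (T := {s}) support_monomial_subset, Finset.sum_singleton, coeff_monomial,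
    if_pos rfl]

theorem fischer_X_mul (i : Fin 3 × Fin m) (p q : Poly m) :
    fischer (X i * p) q = fischer p (pderiv i q) := by
  induction p using MvPolynomial.induction_on' with
  | monomial s c =>
    rw [X, monomial_mul, one_mul, add_comm, fischer_monomial, fischer_monomial,
      fischerWeight_add_single, coeff_pderiv]
    ring
  | add p p' hp hp' => rw [mul_add, fischer_add_left, fischer_add_left, hp, hp']

theorem fischer_pderiv (i : Fin 3 × Fin m) (p q : Poly m) :
    fischer (pderiv i p) q = fischer p (X i * q) := by
  rw [← fischer_conj_symm, ← fischer_X_mul, fischer_conj_symm]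

/-- The angular momentum operators are skew-adjoint for the Fischer inner product. -/
theorem fischer_rot (a b : Fin m) (p q : Poly m) :
    fischer (rot a b p) q = fischer p (rot b a q) := by
  simp only [rot_apply, Fin.sum_univ_three, fischer_add_left, fischer_add_right, fischer_sub_left,
    fischer_sub_right, fischer_X_mul, fischer_pderiv]

/-- Complete reducibility reduces irreducibility to the existence of a vector contained in every
nonzero invariant subspace: such a vector would otherwise be contained in an invariant subspace
and in its orthogonal complement. -/
theorem soIrreducible_of_forall_mem {W : Submodule ℂ (Poly m)} [FiniteDimensional ℂ W]
    (hW : SoInvariant W) {w : Poly m} (hw : w ∈ W) (hw0 : w ≠ 0)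
    (h : ∀ U ≤ W, SoInvariant U → U ≠ ⊥ → w ∈ U) : SoIrreducible W := by
  refine ⟨(Submodule.ne_bot_iff _).2 ⟨w, hw, hw0⟩, hW, fun U hU hUinv => ?_⟩
  by_contra! hne
  let : NormedAddCommGroup (Poly m) := (fischerCore m).toNormedAddCommGroup
  let : InnerProductSpace ℂ (Poly m) := InnerProductSpace.ofCore (fischerCore m).toCore
  have : FiniteDimensional ℂ U := Submodule.finiteDimensional_of_le hU
  have hinner : ∀ p q : Poly m, inner ℂ p q = fischer p q := fun _ _ => rfl
  have hsup := Submodule.sup_orthogonal_inf_of_hasOrthogonalProjection hU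
  have hV : Uᗮ ⊓ W ≠ ⊥ := fun hV => hne.2 (by rw [← hsup, hV, sup_bot_eq])
  have hVinv : SoInvariant (Uᗮ ⊓ W) := by
    intro a b p hp
    refine ⟨(Submodule.mem_orthogonal _ _).2 fun q hq => ?_, hW a b p hp.2⟩
    rw [hinner, ← fischer_rot, ← hinner]
    exact (Submodule.mem_orthogonal _ _).1 hp.1 _ (hUinv b a q hq)
  have h1 := h U hU hUinv hne.1
  have h2 := h _ inf_le_right hVinv hV
  exact hw0 (inner_self_eq_zero.1 ((Submodule.mem_orthogonal _ _).1 h2.1 w h1))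

/-! ### Raising operators -/

/-- The isotropic coordinate `u_{i₀} + i u_{i₁}` of the vector variable `u`. -/
noncomputable def isoCoord (i₀ i₁ : Fin m) (u : Fin 3) : Poly m :=
  X (u, i₀) + C Complex.I * X (u, i₁)

/-- The derivation `∂_{u_{i₀}} + i ∂_{u_{i₁}}`, which annihilates `isoCoord`. -/
noncomputable def isoDer (i₀ i₁ : Fin m) (u : Fin 3) : Derivation ℂ (Poly m) (Poly m) :=
  pderiv (u, i₀) + Complex.I • pderiv (u, i₁)

/-- The derivation `∂_{u_{i₀}} - i ∂_{u_{i₁}}`. -/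
noncomputable def isoDerConj (i₀ i₁ : Fin m) (u : Fin 3) : Derivation ℂ (Poly m) (Poly m) :=
  pderiv (u, i₀) - Complex.I • pderiv (u, i₁)

theorem isoDer_apply (i₀ i₁ : Fin m) (u : Fin 3) (p : Poly m) :
    isoDer i₀ i₁ u p = pderiv (u, i₀) p + Complex.I • pderiv (u, i₁) p := rfl

theorem isoDerConj_apply (i₀ i₁ : Fin m) (u : Fin 3) (p : Poly m) :
    isoDerConj i₀ i₁ u p = pderiv (u, i₀) p - Complex.I • pderiv (u, i₁) p := rfl

/-- The raising operators `∑ u, (ζ_u ∂_{u_j} - u_j (∂_{u_{i₀}} + i ∂_{u_{i₁}}))` with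
`ζ_u = isoCoord i₀ i₁ u`. They span an abelian subalgebra of the complexification of `so(m)`, the
nilradical of the stabilizer of an isotropic line. -/
noncomputable def raise (i₀ i₁ j : Fin m) : Derivation ℂ (Poly m) (Poly m) :=
  rotDer i₀ j + Complex.I • rotDer i₁ j

theorem raise_apply_eq_rot (i₀ i₁ j : Fin m) (p : Poly m) :
    raise i₀ i₁ j p = rot i₀ j p + Complex.I • rot i₁ j p := by
  rw [← rotDer_apply, ← rotDer_apply]
  rfl

theorem raise_apply (i₀ i₁ j : Fin m) (p : Poly m) :
    raise i₀ i₁ j p =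
      ∑ u : Fin 3, (isoCoord i₀ i₁ u * pderiv (u, j) p - X (u, j) * isoDer i₀ i₁ u p) := by
  rw [raise_apply_eq_rot, rot_apply, rot_apply, Finset.smul_sum, ← Finset.sum_add_distrib]
  refine Finset.sum_congr rfl fun u _ => ?_
  simp only [isoCoord, isoDer_apply, smul_eq_C_mul]
  ring

theorem SoInvariant.raise_mem {W : Submodule ℂ (Poly m)} (hW : SoInvariant W) (i₀ i₁ j : Fin m)
    {p : Poly m} (hp : p ∈ W) : raise i₀ i₁ j p ∈ W := by
  rw [raise_apply_eq_rot]
  exact W.add_mem (hW _ _ _ hp) (W.smul_mem _ (hW _ _ _ hp))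

theorem isoDer_isoCoord {i₀ i₁ : Fin m} (h01 : i₀ ≠ i₁) (u v : Fin 3) :
    isoDer i₀ i₁ u (isoCoord i₀ i₁ v) = 0 := by
  rw [isoDer_apply, isoCoord]
  by_cases h : v = u
  · subst h
    simp [h01, h01.symm, smul_eq_C_mul, ← C_mul]
  · simp [h]

theorem isoDerConj_isoCoord {i₀ i₁ : Fin m} (h01 : i₀ ≠ i₁) (u v : Fin 3) :
    isoDerConj i₀ i₁ u (isoCoord i₀ i₁ v) = if v = u then 2 else 0 := by
  rw [isoDerConj_apply, isoCoord]
  by_cases h : v = u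
  · subst h
    simp [h01, h01.symm, smul_eq_C_mul, ← C_mul]
    norm_num
  · simp [h]

theorem raise_isoCoord {i₀ i₁ : Fin m} (h01 : i₀ ≠ i₁) {j : Fin m} (h0 : j ≠ i₀)
    (h1 : j ≠ i₁) (u : Fin 3) : raise i₀ i₁ j (isoCoord i₀ i₁ u) = 0 := by
  rw [raise_apply]
  refine Finset.sum_eq_zero fun v _ => ?_
  rw [isoDer_isoCoord h01]
  simp [isoCoord, h0.symm, h1.symm]

theorem raise_X_self {i₀ i₁ : Fin m} {j : Fin m} (h0 : j ≠ i₀) (h1 : j ≠ i₁) (u : Fin 3) :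
    raise i₀ i₁ j (X (u, j)) = isoCoord i₀ i₁ u := by
  rw [raise_apply_eq_rot, rot_X, rot_X]
  simp [h0, h1, isoCoord, smul_eq_C_mul]

theorem raise_X_fst {i₀ i₁ : Fin m} (h01 : i₀ ≠ i₁) {j : Fin m} (h0 : j ≠ i₀) (u : Fin 3) :
    raise i₀ i₁ j (X (u, i₀)) = -X (u, j) := by
  rw [raise_apply_eq_rot, rot_X, rot_X]
  simp [h0.symm, h01]

theorem raise_X_snd {i₀ i₁ : Fin m} (h01 : i₀ ≠ i₁) {j : Fin m} (h1 : j ≠ i₁) (u : Fin 3) :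
    raise i₀ i₁ j (X (u, i₁)) = -Complex.I • X (u, j) := by
  rw [raise_apply_eq_rot, rot_X, rot_X]
  simp [h1.symm, h01.symm]

theorem raise_X_of_ne {i₀ i₁ : Fin m} {j k : Fin m} (h0 : k ≠ i₀) (h1 : k ≠ i₁) (hj : k ≠ j)
    (u : Fin 3) : raise i₀ i₁ j (X (u, k)) = 0 := by
  rw [raise_apply_eq_rot, rot_X, rot_X]
  simp [h0, h1, hj]

theorem raise_comm {i₀ i₁ : Fin m} (h01 : i₀ ≠ i₁) {j k : Fin m} (hj0 : j ≠ i₀) (hj1 : j ≠ i₁)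
    (hk0 : k ≠ i₀) (hk1 : k ≠ i₁) (p : Poly m) :
    raise i₀ i₁ j (raise i₀ i₁ k p) = raise i₀ i₁ k (raise i₀ i₁ j p) := by
  rw [← sub_eq_zero, ← Derivation.commutator_apply]
  have h : ⁅raise i₀ i₁ j, raise i₀ i₁ k⁆ = 0 := by
    refine derivation_ext fun ⟨u, l⟩ => ?_
    rw [Derivation.commutator_apply, Derivation.zero_apply]
    by_cases hjk : j = k
    · subst hjk
      exact sub_self _
    rcases eq_or_ne l i₀ with rfl | hl0
    · rw [raise_X_fst h01 hj0, raise_X_fst h01 hk0, map_neg, map_neg,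
        raise_X_of_ne hk0 hk1 (Ne.symm hjk), raise_X_of_ne hj0 hj1 hjk, sub_self]
    rcases eq_or_ne l i₁ with rfl | hl1
    · rw [raise_X_snd h01 hj1, raise_X_snd h01 hk1, Derivation.map_smul, Derivation.map_smul,
        raise_X_of_ne hk0 hk1 (Ne.symm hjk), raise_X_of_ne hj0 hj1 hjk, sub_self]
    rcases eq_or_ne l j with rfl | hlj
    · rw [raise_X_self hj0 hj1, raise_X_of_ne hj0 hj1 hjk, map_zero,
        raise_isoCoord h01 hk0 hk1, sub_self]
    rcases eq_or_ne l k with rfl | hlk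
    · rw [raise_X_self hk0 hk1, raise_X_of_ne hk0 hk1 hlj, map_zero,
        raise_isoCoord h01 hj0 hj1, sub_self]
    rw [raise_X_of_ne hl0 hl1 hlj, raise_X_of_ne hl0 hl1 hlk, map_zero, map_zero, sub_self]
  rw [h, Derivation.zero_apply]

/-- The polynomial `p` is annihilated by a power of the derivation `D`. -/
def NilpotentAt (D : Derivation ℂ (Poly m) (Poly m)) (p : Poly m) : Prop := ∃ N, D^[N] p = 0

theorem iterate_derivation_eq_zero_of_le {D : Derivation ℂ (Poly m) (Poly m)} {N M : ℕ}
    {f : Poly m} (hNM : N ≤ M) (hf : D^[N] f = 0) : D^[M] f = 0 := by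
  rw [← Nat.sub_add_cancel hNM, Function.iterate_add_apply, hf,
    Function.iterate_fixed (map_zero D)]

theorem NilpotentAt.add {D : Derivation ℂ (Poly m) (Poly m)} {p q : Poly m}
    (hp : NilpotentAt D p) (hq : NilpotentAt D q) : NilpotentAt D (p + q) := by
  obtain ⟨N, hN⟩ := hp
  obtain ⟨M, hM⟩ := hq
  refine ⟨max N M, ?_⟩
  rw [iterate_map_add, iterate_derivation_eq_zero_of_le (le_max_left _ _) hN,
    iterate_derivation_eq_zero_of_le (le_max_right _ _) hM, add_zero]

/-- If multiplication by `D q` preserves the polynomials that are annihilated by a power of `D`,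
then so does multiplication by `q`. -/
theorem NilpotentAt.mul {D : Derivation ℂ (Poly m) (Poly m)} {q : Poly m}
    (hq : ∀ p, NilpotentAt D p → NilpotentAt D (p * D q)) (p : Poly m)
    (hp : NilpotentAt D p) : NilpotentAt D (p * q) := by
  obtain ⟨N, hN⟩ := hp
  induction N generalizing p with
  | zero =>
    rw [Function.iterate_zero, id] at hN
    exact ⟨0, by simp [hN]⟩
  | succ N ih =>
    have h₁ := ih (D p) (by rwa [Function.iterate_succ_apply] at hN)
    obtain ⟨M, hM⟩ := (hq p ⟨_, hN⟩).add h₁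
    refine ⟨M + 1, ?_⟩
    rw [Function.iterate_succ_apply, Derivation.leibniz, smul_eq_mul, smul_eq_mul, mul_comm q, hM]

theorem NilpotentAt.mul_of_apply_eq_zero {D : Derivation ℂ (Poly m) (Poly m)} {q : Poly m}
    (hq : D q = 0) (p : Poly m) (hp : NilpotentAt D p) : NilpotentAt D (p * q) :=
  NilpotentAt.mul (fun p _ => ⟨0, by rw [hq, mul_zero, Function.iterate_zero, id]⟩) p hp

/-- The raising operators are locally nilpotent. -/
theorem nilpotentAt_raise {i₀ i₁ : Fin m} (h01 : i₀ ≠ i₁) {j : Fin m} (h0 : j ≠ i₀)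
    (h1 : j ≠ i₁) (p : Poly m) : NilpotentAt (raise i₀ i₁ j) p := by
  have hj : ∀ u (c : ℂ) p, NilpotentAt (raise i₀ i₁ j) p →
      NilpotentAt (raise i₀ i₁ j) (p * (c • X (u, j))) := fun u c => by
    refine NilpotentAt.mul ?_
    rw [Derivation.map_smul, raise_X_self h0 h1]
    refine NilpotentAt.mul_of_apply_eq_zero ?_
    rw [Derivation.map_smul, raise_isoCoord h01 h0 h1, smul_zero]
  induction p using MvPolynomial.induction_on with
  | C c => exact ⟨1, by rw [Function.iterate_one, derivation_C]⟩
  | add p q hp hq => exact hp.add hq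
  | mul_X p i hp =>
    obtain ⟨u, k⟩ := i
    rcases eq_or_ne k i₀ with rfl | hk0
    · refine NilpotentAt.mul ?_ p hp
      rw [raise_X_fst h01 h0, ← neg_one_smul ℂ (X _)]
      exact hj u (-1)
    rcases eq_or_ne k i₁ with rfl | hk1
    · refine NilpotentAt.mul ?_ p hp
      rw [raise_X_snd h01 h1]
      exact hj u (-Complex.I)
    rcases eq_or_ne k j with rfl | hkj
    · rw [← one_smul ℂ (X _)]
      exact hj u 1 p hp
    · exact NilpotentAt.mul_of_apply_eq_zero (raise_X_of_ne hk0 hk1 hkj u) p hp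

/-- A nonzero invariant subspace contains a nonzero polynomial that is annihilated by all raising
operators. -/
theorem SoInvariant.exists_raise_eq_zero {U : Submodule ℂ (Poly m)} (hU : SoInvariant U)
    (hne : U ≠ ⊥) {i₀ i₁ : Fin m} (h01 : i₀ ≠ i₁) :
    ∃ p ∈ U, p ≠ 0 ∧ ∀ j, j ≠ i₀ → j ≠ i₁ → raise i₀ i₁ j p = 0 := by
  suffices h : ∀ s : Finset (Fin m), (∀ j ∈ s, j ≠ i₀ ∧ j ≠ i₁) →
      ∃ p ∈ U, p ≠ 0 ∧ ∀ j ∈ s, raise i₀ i₁ j p = 0 by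
    obtain ⟨p, hp, hp0, hpj⟩ := h (Finset.univ.filter fun j => j ≠ i₀ ∧ j ≠ i₁) (by simp)
    exact ⟨p, hp, hp0, fun j h0 h1 => hpj j (by simp [h0, h1])⟩
  intro s
  induction s using Finset.induction_on with
  | empty =>
    intro _
    obtain ⟨p, hp, hp0⟩ := U.ne_bot_iff.1 hne
    exact ⟨p, hp, hp0, by simp⟩
  | insert k s _ ih =>
    intro hs
    have hk := hs k (Finset.mem_insert_self _ _)
    obtain ⟨p, hp, hp0, hps⟩ := ih fun j hj => hs j (Finset.mem_insert_of_mem hj)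
    have hnil : ∃ N, (raise i₀ i₁ k)^[N] p = 0 := nilpotentAt_raise h01 hk.1 hk.2 p
    classical
    obtain ⟨N, hN⟩ : ∃ N, Nat.find hnil = N + 1 := Nat.exists_eq_succ_of_ne_zero fun h0 =>
      hp0 ((Nat.find_eq_zero hnil).1 h0)
    have hmem : ∀ n, (raise i₀ i₁ k)^[n] p ∈ U ∧
        ∀ j ∈ s, raise i₀ i₁ j ((raise i₀ i₁ k)^[n] p) = 0 := by
      intro n
      induction n with
      | zero => exact ⟨hp, hps⟩
      | succ n ihn =>
        rw [Function.iterate_succ_apply']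
        refine ⟨hU.raise_mem _ _ _ ihn.1, fun j hj => ?_⟩
        have hj' := hs j (Finset.mem_insert_of_mem hj)
        rw [raise_comm h01 hj'.1 hj'.2 hk.1 hk.2, ihn.2 j hj, map_zero]
    refine ⟨(raise i₀ i₁ k)^[N] p, (hmem N).1, Nat.find_min hnil (by omega), fun j hj => ?_⟩
    rcases Finset.mem_insert.1 hj with rfl | hj
    · have := Nat.find_spec hnil
      rwa [hN, Function.iterate_succ_apply'] at this
    · exact (hmem N).2 j hj

/-! ### Polynomials annihilated by the raising operators -/

/-- The indices different from `i₀` and `i₁`. -/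
def perp (i₀ i₁ : Fin m) : Finset (Fin m) := Finset.univ.filter fun j => j ≠ i₀ ∧ j ≠ i₁

theorem mem_perp {i₀ i₁ j : Fin m} : j ∈ perp i₀ i₁ ↔ j ≠ i₀ ∧ j ≠ i₁ := by simp [perp]

theorem sum_eq_add_sum_perp {M : Type*} [AddCommMonoid M] {i₀ i₁ : Fin m} (h01 : i₀ ≠ i₁)
    (f : Fin m → M) : ∑ j, f j = f i₀ + f i₁ + ∑ j ∈ perp i₀ i₁, f j := by
  rw [← Finset.sum_filter_add_sum_filter_not Finset.univ (fun j => ¬ (j ≠ i₀ ∧ j ≠ i₁)) f]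
  have h : Finset.univ.filter (fun j => ¬ (j ≠ i₀ ∧ j ≠ i₁)) = {i₀, i₁} := by
    ext j
    simp only [Finset.mem_filter, Finset.mem_univ, true_and, Finset.mem_insert,
      Finset.mem_singleton]
    tauto
  rw [h, Finset.sum_pair h01]
  simp only [not_not, perp]

theorem card_perp {i₀ i₁ : Fin m} (h01 : i₀ ≠ i₁) : (perp i₀ i₁).card + 2 = m := by
  have h := sum_eq_add_sum_perp h01 fun _ => 1
  simp only [Finset.sum_const, Finset.card_univ, Fintype.card_fin, smul_eq_mul, mul_one] at h
  omega

/-- The two coordinates `i₀`, `i₁` of `⟨∂_u, ∂_v⟩` in terms of the derivatives along the isotropic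
coordinates. -/
theorem innerD_split {i₀ i₁ : Fin m} (h01 : i₀ ≠ i₁) (u v : Fin 3) (p : Poly m) :
    innerD u v p = (1 / 2 : ℂ) • (isoDerConj i₀ i₁ v (isoDer i₀ i₁ u p) +
      isoDerConj i₀ i₁ u (isoDer i₀ i₁ v p)) +
        ∑ j ∈ perp i₀ i₁, pderiv (u, j) (pderiv (v, j) p) := by
  rw [innerD_apply, sum_eq_add_sum_perp h01]
  congr 1
  simp only [isoDer_apply, isoDerConj_apply, map_add, Derivation.map_smul, smul_add, smul_sub,
    smul_smul]
  rw [pderiv_comm (v, i₀) (u, i₀), pderiv_comm (v, i₁) (u, i₁), pderiv_comm (v, i₀) (u, i₁),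
    pderiv_comm (v, i₁) (u, i₀)]
  have hI : (1 / 2 : ℂ) * (Complex.I * Complex.I) = -(1 / 2) := by rw [Complex.I_mul_I]; ring
  rw [hI]
  module

/-- On polynomials that do not involve the coordinate of `v` conjugate to `isoCoord`, only the
isotropic coordinate contributes to the part of `⟨u, ∂_v⟩` with indices `i₀`, `i₁`. -/
theorem skewOp_split {i₀ i₁ : Fin m} (h01 : i₀ ≠ i₁) (u v : Fin 3) {p : Poly m}
    (hp : isoDer i₀ i₁ v p = 0) :
    skewOp u v p = (1 / 2 : ℂ) • (isoCoord i₀ i₁ u * isoDerConj i₀ i₁ v p) +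
      ∑ j ∈ perp i₀ i₁, X (u, j) * pderiv (v, j) p := by
  rw [skewOp_apply, sum_eq_add_sum_perp h01]
  congr 1
  rw [isoDer_apply, add_eq_zero_iff_eq_neg] at hp
  rw [isoDerConj_apply, hp, isoCoord]
  have hI : (C Complex.I : Poly m) * C Complex.I = -1 := by
    rw [← C_mul, Complex.I_mul_I, C_neg, C_1]
  have h2 : (C (1 / 2) : Poly m) * 2 = 1 := by
    rw [← map_ofNat (C : ℂ →+* Poly m) 2, ← C_mul]; norm_num
  simp only [smul_eq_C_mul]
  linear_combination (C Complex.I * X (u, i₀) - X (u, i₁)) * pderiv (v, i₁) p * h2 +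
    X (u, i₁) * pderiv (v, i₁) p * (C (1 / 2) * 2) * hI

theorem pderiv_isoDer (i₀ i₁ : Fin m) (v u : Fin 3) (j : Fin m) (p : Poly m) :
    pderiv (v, j) (isoDer i₀ i₁ u p) = isoDer i₀ i₁ u (pderiv (v, j) p) := by
  simp only [isoDer_apply, map_add, Derivation.map_smul]
  rw [pderiv_comm (v, j), pderiv_comm (v, j)]

theorem isoDer_comm (i₀ i₁ : Fin m) (v u : Fin 3) (p : Poly m) :
    isoDer i₀ i₁ v (isoDer i₀ i₁ u p) = isoDer i₀ i₁ u (isoDer i₀ i₁ v p) := by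
  rw [isoDer_apply, pderiv_isoDer, pderiv_isoDer, isoDer_apply _ _ v, map_add,
    Derivation.map_smul]

theorem innerD_isoDer (i₀ i₁ : Fin m) (v w u : Fin 3) (p : Poly m) :
    innerD v w (isoDer i₀ i₁ u p) = isoDer i₀ i₁ u (innerD v w p) := by
  simp only [isoDer_apply, map_add, map_smul, pderiv_innerD]

theorem isoDer_skewOp (i₀ i₁ : Fin m) (v u w : Fin 3) (p : Poly m) :
    isoDer i₀ i₁ v (skewOp u w p) =
      (if v = u then isoDer i₀ i₁ w p else 0) + skewOp u w (isoDer i₀ i₁ v p) := by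
  simp only [isoDer_apply, pderiv_skewOp, map_add, map_smul]
  split_ifs <;> simp only [smul_add, smul_zero] <;> abel

theorem isoDer_mem_homog {i₀ i₁ : Fin m} {d d' : Fin 3 → ℤ} {p : Poly m} (hp : p ∈ homog m d)
    (u : Fin 3) (h : d' + Pi.single u 1 = d) : isoDer i₀ i₁ u p ∈ homog m d' :=
  Submodule.add_mem _ (pderiv_mem_homog hp u _ h)
    (Submodule.smul_mem _ _ (pderiv_mem_homog hp u _ h))

theorem raise_isoDer {i₀ i₁ j : Fin m} (h01 : i₀ ≠ i₁) (h0 : j ≠ i₀) (h1 : j ≠ i₁) (u : Fin 3)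
    (p : Poly m) : raise i₀ i₁ j (isoDer i₀ i₁ u p) = isoDer i₀ i₁ u (raise i₀ i₁ j p) := by
  simp only [raise_apply_eq_rot, isoDer_apply, map_add, rot_pderiv, Derivation.map_smul,
    h0.symm, h1.symm, h01, h01.symm, if_true, if_false, smul_add, smul_sub, smul_smul,
    Complex.I_mul_I, neg_smul, one_smul, smul_zero]
  abel

theorem pderiv_isoCoord {i₀ i₁ j : Fin m} (h0 : j ≠ i₀) (h1 : j ≠ i₁) (v u : Fin 3) :
    pderiv (v, j) (isoCoord i₀ i₁ u) = 0 := by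
  simp [isoCoord, h0.symm, h1.symm]

theorem isoCoord_ne_zero {i₀ i₁ : Fin m} (h01 : i₀ ≠ i₁) (u : Fin 3) : isoCoord i₀ i₁ u ≠ 0 := by
  intro h
  have := congrArg (pderiv (u, i₀)) h
  simp [isoCoord, h01.symm] at this

/-- The raising operator in the case of polynomials that depend on `u` and `v` only. -/
theorem raise_apply_of_two (i₀ i₁ j : Fin m) {u v : Fin 3} (huv : u ≠ v) {p : Poly m}
    (hp : ∀ w, w ≠ u → w ≠ v → ∀ i, pderiv (w, i) p = 0) :
    raise i₀ i₁ j p = (isoCoord i₀ i₁ u * pderiv (u, j) p - X (u, j) * isoDer i₀ i₁ u p) +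
      (isoCoord i₀ i₁ v * pderiv (v, j) p - X (v, j) * isoDer i₀ i₁ v p) := by
  rw [raise_apply]
  refine Finset.sum_eq_add u v huv (fun w _ hw => ?_) (by simp) (by simp)
  rw [isoDer_apply, hp w hw.1 hw.2, hp w hw.1 hw.2, hp w hw.1 hw.2]
  simp

theorem coeff_X_mul_pderiv (i : Fin 3 × Fin m) (s : Fin 3 × Fin m →₀ ℕ) (p : Poly m) :
    coeff s (X i * pderiv i p) = s i * coeff s p := by
  induction p using MvPolynomial.induction_on' with
  | monomial t r =>
    rw [X_mul_pderiv_monomial, coeff_smul, coeff_monomial]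
    split_ifs with h
    · rw [h, nsmul_eq_mul]
    · simp
  | add p q hp hq => rw [map_add, mul_add, coeff_add, hp, hq, coeff_add, mul_add]

/-- The Euler operator in the coordinates of `u` and `v` with indices different from `i₀` and
`i₁` has no eigenvalue above the degree. -/
theorem eq_zero_of_perp_euler {i₀ i₁ : Fin m} (u v : Fin 3) {d : Fin 3 → ℤ} {p : Poly m}
    (hp : p ∈ homog m d) {n : ℤ} (hn : d u + d v < n)
    (h : ∑ j ∈ perp i₀ i₁, X (u, j) * pderiv (u, j) p +
      ∑ j ∈ perp i₀ i₁, X (v, j) * pderiv (v, j) p = (n : ℂ) • p) : p = 0 := by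
  ext s
  by_contra hs
  have hc := congrArg (coeff s) h
  rw [coeff_add, coeff_sum, coeff_sum, coeff_smul, smul_eq_mul] at hc
  simp only [coeff_X_mul_pderiv] at hc
  rw [← Finset.sum_mul, ← Finset.sum_mul, ← add_mul] at hc
  have hc' : ((∑ j ∈ perp i₀ i₁, s (u, j) + ∑ j ∈ perp i₀ i₁, s (v, j) : ℕ) : ℤ) = n := by
    exact_mod_cast mul_right_cancel₀ hs hc
  have hle : ∀ w, ∑ j ∈ perp i₀ i₁, s (w, j) ≤ degOf w s := fun w =>
    Finset.sum_le_sum_of_subset (Finset.subset_univ _)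
  have h1 := hle u
  have h2 := hle v
  have h3 := mem_homog_iff.1 hp s hs u
  have h4 := mem_homog_iff.1 hp s hs v
  omega

/-- A homogeneous polynomial in `u` that is constant along all directions except that of the
isotropic coordinate is a multiple of a power of this coordinate. -/
theorem exists_eq_smul_isoCoord_pow {i₀ i₁ : Fin m} (h01 : i₀ ≠ i₁) (u : Fin 3) (k : ℕ) :
    ∀ f ∈ homog m (Pi.single u (k : ℤ)), isoDer i₀ i₁ u f = 0 →
      (∀ j ∈ perp i₀ i₁, pderiv (u, j) f = 0) → ∃ c : ℂ, f = c • isoCoord i₀ i₁ u ^ k := by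
  induction k with
  | zero =>
    intro f hf _ _
    refine ⟨coeff 0 f, ?_⟩
    rw [pow_zero, smul_eq_C_mul, mul_one]
    ext s
    rw [coeff_C]
    split_ifs with h
    · rw [h]
    · by_contra hs
      refine h (Finsupp.ext fun ⟨v, j⟩ => ?_)
      have h1 : degOf v s = 0 := by simpa using mem_homog_iff.1 hf s hs v
      exact ((Finset.sum_eq_zero_iff.1 h1) j (Finset.mem_univ j)).symm
  | succ k ih =>
    intro f hf hD hperp
    obtain ⟨c, hc⟩ := ih (pderiv (u, i₀) f)
      (pderiv_mem_homog hf u _ (by rw [← Pi.single_add, Nat.cast_succ]))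
      (by rw [← pderiv_isoDer, hD, map_zero])
      (fun j hj => by rw [pderiv_comm, hperp j hj, map_zero])
    have he := euler_of_mem_homog hf u
    rw [euler, skewOp_split h01 u u hD,
      Finset.sum_eq_zero fun j hj => by rw [hperp j hj, mul_zero], add_zero] at he
    have hconj : isoDerConj i₀ i₁ u f = (2 : ℂ) • pderiv (u, i₀) f := by
      rw [isoDer_apply, add_eq_zero_iff_eq_neg'] at hD
      rw [isoDerConj_apply, hD]
      module
    have hk : (k : ℂ) + 1 ≠ 0 := Nat.cast_add_one_ne_zero k
    refine ⟨c / (k + 1), ?_⟩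
    have h2 : ((k : ℂ) + 1) • f = c • isoCoord i₀ i₁ u ^ (k + 1) := by
      rw [hconj, hc] at he
      simp only [Pi.single_eq_same, Nat.cast_succ, Int.cast_add, Int.cast_natCast,
        Int.cast_one] at he
      rw [← he, mul_smul_comm, mul_smul_comm, smul_smul, pow_succ']
      norm_num
    rw [div_eq_inv_mul, mul_smul, ← h2, smul_smul, inv_mul_cancel₀ hk, one_smul]

/-- A harmonic polynomial that is annihilated by the raising operators depends on the isotropic
coordinate only. -/
theorem isoDer_eq_zero_of_mem_harm {i₀ i₁ : Fin m} (h01 : i₀ ≠ i₁) (hm : 3 ≤ m) (k : ℕ) :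
    ∀ f ∈ harm m k, (∀ j ∈ perp i₀ i₁, raise i₀ i₁ j f = 0) → isoDer i₀ i₁ vz f = 0 := by
  induction k with
  | zero =>
    intro f hf _
    rw [isoDer_apply, pderiv_eq_zero_of_mem_homog hf.1 (by simp),
      pderiv_eq_zero_of_mem_homog hf.1 (by simp), smul_zero, add_zero]
  | succ k ih =>
    intro f hf hraise
    obtain ⟨hf1, hf2⟩ := mem_harm_iff.1 hf
    set g := isoDer i₀ i₁ vz f with hg
    have hg1 : g ∈ homog m (Pi.single vz (k : ℤ)) :=
      isoDer_mem_homog hf1 vz (by rw [← Pi.single_add, Nat.cast_succ])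
    have hDg : isoDer i₀ i₁ vz g = 0 := by
      refine ih g (mem_harm_iff.2 ⟨hg1, by rw [hg, innerD_isoDer, hf2, map_zero]⟩) fun j hj => ?_
      rw [hg, raise_isoDer h01 (mem_perp.1 hj).1 (mem_perp.1 hj).2, hraise j hj, map_zero]
    have hx : ∀ q : Poly m, ∀ d : ℤ, q ∈ homog m (Pi.single vz d) → ∀ w, w ≠ vz → ∀ i,
        pderiv (w, i) q = 0 := fun q d hq w hw i =>
      pderiv_eq_zero_of_mem_homog hq (by simp [hw]) i
    have hj : ∀ j ∈ perp i₀ i₁, isoCoord i₀ i₁ vz * pderiv (vz, j) f = X (vz, j) * g := by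
      intro j hj
      have h := hraise j hj
      rw [raise_apply_of_two i₀ i₁ j (show vx ≠ vz by decide)
        fun w _ hw i => hx f _ hf1 w hw i, isoDer_apply _ _ vx, hx f _ hf1 vx (by decide),
        hx f _ hf1 vx (by decide), hx f _ hf1 vx (by decide)] at h
      simpa [sub_eq_zero] using h
    -- differentiate the raising equations and sum: an equation for `∑ j, ∂_{z_j}² f`
    have hsum : isoCoord i₀ i₁ vz * ∑ j ∈ perp i₀ i₁, pderiv (vz, j) (pderiv (vz, j) f) =
        ((perp i₀ i₁).card : ℂ) • g + ∑ j ∈ perp i₀ i₁, X (vz, j) * pderiv (vz, j) g := by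
      rw [Finset.mul_sum, Nat.cast_smul_eq_nsmul, ← Finset.sum_const, ← Finset.sum_add_distrib]
      refine Finset.sum_congr rfl fun j hj' => ?_
      have h := congrArg (pderiv (vz, j)) (hj j hj')
      rw [pderiv_mul, pderiv_isoCoord (mem_perp.1 hj').1 (mem_perp.1 hj').2, zero_mul, zero_add,
        pderiv_mul, pderiv_X_self, one_mul] at h
      exact h
    have hlap := innerD_split h01 vz vz f
    rw [hf2, ← hg] at hlap
    have heul := euler_of_mem_homog hg1 vz
    rw [euler, skewOp_split h01 _ _ hDg, Pi.single_eq_same, Int.cast_natCast] at heul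
    have hcard : ((perp i₀ i₁).card : ℂ) = m - 2 := by
      rw [eq_sub_iff_add_eq]
      exact_mod_cast card_perp h01
    refine eq_zero_of_perp_euler (i₀ := i₀) (i₁ := i₁) vz vx hg1 (n := 2 * k + m - 2)
      (by simp [show vx ≠ vz by decide]; omega) ?_
    have hzero : ∑ j ∈ perp i₀ i₁, X (vx, j) * pderiv (vx, j) g = 0 :=
      Finset.sum_eq_zero fun j _ => by rw [hx g _ hg1 vx (by decide), mul_zero]
    rw [hzero, add_zero]
    rw [hcard] at hsum
    push_cast
    have h3 : isoCoord i₀ i₁ vz * ∑ j ∈ perp i₀ i₁, pderiv (vz, j) (pderiv (vz, j) f) =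
        - (isoCoord i₀ i₁ vz * isoDerConj i₀ i₁ vz g) := by
      rw [← two_smul ℂ (isoDerConj _ _ _ _), smul_smul] at hlap
      norm_num at hlap
      rw [eq_neg_iff_add_eq_zero, ← mul_add, add_comm, ← hlap, mul_zero]
    rw [h3] at hsum
    -- together with Euler's identity the Laplace equation makes `g` an eigenvector of the Euler
    -- operator in the coordinates `perp`, with eigenvalue above the degree of `g`
    set A := isoCoord i₀ i₁ vz * isoDerConj i₀ i₁ vz g
    set B := ∑ j ∈ perp i₀ i₁, X (vz, j) * pderiv (vz, j) g
    linear_combination (norm := module) (2 : ℂ) • heul + hsum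


/-- A simplicial harmonic of degree one in `u` that is annihilated by the raising operators does not
involve the coordinate conjugate to the isotropic coordinate. -/
theorem isoDer_eq_zero_of_mem_simpHarm {i₀ i₁ : Fin m} (h01 : i₀ ≠ i₁) (hm : 4 ≤ m) {u : Fin 3}
    (hu : u ≠ vz) (k : ℕ) : ∀ F ∈ simpHarm m u k 1, (∀ j ∈ perp i₀ i₁, raise i₀ i₁ j F = 0) →
      isoDer i₀ i₁ u F = 0 ∧ isoDer i₀ i₁ vz F = 0 := by
  have hcard : ((perp i₀ i₁).card : ℂ) = m - 2 := by
    rw [eq_sub_iff_add_eq]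
    exact_mod_cast card_perp h01
  induction k with
  | zero =>
    intro F hF _
    obtain ⟨h1, -, -, -, h5⟩ := mem_simpHarm_iff.1 hF
    have hFz : isoDer i₀ i₁ vz F = 0 := by
      rw [isoDer_apply, pderiv_eq_zero_of_mem_homog h1 (by simp [hu]),
        pderiv_eq_zero_of_mem_homog h1 (by simp [hu]), smul_zero, add_zero]
    refine ⟨?_, hFz⟩
    have h := congrArg (isoDer i₀ i₁ vz) h5
    rwa [isoDer_skewOp, if_pos rfl, hFz, map_zero, map_zero, add_zero] at h
  | succ k ih =>
    intro F hF hraise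
    obtain ⟨h1, h2, h3, h4, h5⟩ := mem_simpHarm_iff.1 hF
    have hx : ∀ w, w ≠ u → w ≠ vz → ∀ i, pderiv (w, i) F = 0 := fun w hw hw' i =>
      pderiv_eq_zero_of_mem_homog h1 (by simp [hw, hw']) i
    set G := isoDer i₀ i₁ vz F with hG
    set Φ := isoDer i₀ i₁ u F with hΦ
    have hΦ1 : Φ ∈ homog m (Pi.single vz ((k + 1 : ℕ) : ℤ)) := isoDer_mem_homog h1 u rfl
    have hG1 : G ∈ homog m (Pi.single vz (k : ℤ) + Pi.single u 1) :=
      isoDer_mem_homog h1 vz (by rw [Nat.cast_succ, Pi.single_add]; abel)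
    have hΦu : ∀ i, pderiv (u, i) Φ = 0 := fun i =>
      pderiv_eq_zero_of_mem_homog hΦ1 (by simp [hu]) i
    have hDΦ : isoDer i₀ i₁ vz Φ = 0 := by
      refine isoDer_eq_zero_of_mem_harm h01 (by omega) (k + 1) Φ
        (mem_harm_iff.2 ⟨hΦ1, by rw [hΦ, innerD_isoDer, h2, map_zero]⟩) fun j hj => ?_
      rw [hΦ, raise_isoDer h01 (mem_perp.1 hj).1 (mem_perp.1 hj).2, hraise j hj, map_zero]
    have hDG : isoDer i₀ i₁ u G = 0 := by rw [hG, isoDer_comm, ← hΦ, hDΦ]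
    have hGΦ : skewOp vz u G = - Φ := by
      have h := congrArg (isoDer i₀ i₁ vz) h5
      rw [isoDer_skewOp, if_pos rfl, map_zero, ← hG, ← hΦ] at h
      rwa [eq_neg_iff_add_eq_zero, add_comm]
    -- the raising equations
    have hj : ∀ j ∈ perp i₀ i₁, isoCoord i₀ i₁ u * pderiv (u, j) F +
        isoCoord i₀ i₁ vz * pderiv (vz, j) F = X (u, j) * Φ + X (vz, j) * G := by
      intro j hj
      have h := hraise j hj
      rw [raise_apply_of_two i₀ i₁ j hu hx, ← hG, ← hΦ] at h
      linear_combination h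
    have hdeg : ∀ i l, pderiv (u, i) (pderiv (u, l) F) = 0 := fun i l =>
      pderiv_eq_zero_of_mem_homog (d := Pi.single vz ((k + 1 : ℕ) : ℤ))
        (pderiv_mem_homog h1 u l rfl) (by simp [hu]) i
    have hsplit := innerD_split h01 vz u F
    rw [h4, ← hG, ← hΦ] at hsplit
    have hP : ∀ v j, j ∈ perp i₀ i₁ → ∀ w, pderiv (v, j) (isoCoord i₀ i₁ w) = 0 :=
      fun v j hj w => pderiv_isoCoord (mem_perp.1 hj).1 (mem_perp.1 hj).2 v w
    -- the divergence in `u` of the raising equations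
    have hsum : isoCoord i₀ i₁ vz * ∑ j ∈ perp i₀ i₁, pderiv (vz, j) (pderiv (u, j) F) =
        ((m : ℂ) - 2) • Φ + ∑ j ∈ perp i₀ i₁, X (vz, j) * pderiv (u, j) G := by
      rw [Finset.mul_sum, ← hcard, Nat.cast_smul_eq_nsmul, ← Finset.sum_const,
        ← Finset.sum_add_distrib]
      refine Finset.sum_congr rfl fun j hj' => ?_
      have h := congrArg (pderiv (u, j)) (hj j hj')
      simp only [map_add, pderiv_mul, hP _ j hj', hdeg, hΦu, pderiv_X_self] at h
      rw [pderiv_X_of_ne (by simp [hu.symm]), pderiv_comm (u, j) (vz, j)] at h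
      linear_combination h
    have hΦ0 : Φ = 0 := by
      -- as in the harmonic case, `Φ` is an eigenvector with eigenvalue above its degree
      have heul := euler_of_mem_homog hΦ1 vz
      rw [euler, skewOp_split h01 _ _ hDΦ, Pi.single_eq_same, Int.cast_natCast] at heul
      rw [skewOp_split h01 _ _ hDG] at hGΦ
      refine eq_zero_of_perp_euler (i₀ := i₀) (i₁ := i₁) vz u hΦ1 (n := k + m - 2)
        (by simp [hu]; omega) ?_
      have hzero : ∑ j ∈ perp i₀ i₁, X (u, j) * pderiv (u, j) Φ = 0 :=
        Finset.sum_eq_zero fun j _ => by rw [hΦu, mul_zero]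
      rw [hzero, add_zero]
      push_cast at heul ⊢
      have h6 := congrArg (fun q => isoCoord i₀ i₁ vz * q) hsplit
      simp only [mul_zero, mul_add, mul_smul_comm] at h6
      linear_combination (norm := module) heul + hsum + hGΦ + h6
    simp only [hΦ0, mul_zero, zero_add, map_zero, add_zero] at hj hsplit
    rw [hΦ0, neg_zero] at hGΦ
    refine ⟨hΦ0, ?_⟩
    obtain ⟨-, hDzG⟩ := ih G (mem_simpHarm_iff.2 ⟨hG1, by rw [hG, innerD_isoDer, h2, map_zero],
      by rw [hG, innerD_isoDer, h3, map_zero], by rw [hG, innerD_isoDer, h4, map_zero], hGΦ⟩)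
      fun j hj => by
        rw [hG, raise_isoDer h01 (mem_perp.1 hj).1 (mem_perp.1 hj).2, hraise j hj, map_zero]
    -- the divergence in `z` of the raising equations
    have hsum' : isoCoord i₀ i₁ u * ∑ j ∈ perp i₀ i₁, pderiv (vz, j) (pderiv (u, j) F) +
        isoCoord i₀ i₁ vz * ∑ j ∈ perp i₀ i₁, pderiv (vz, j) (pderiv (vz, j) F) =
        ((m : ℂ) - 2) • G + ∑ j ∈ perp i₀ i₁, X (vz, j) * pderiv (vz, j) G := by
      rw [Finset.mul_sum, Finset.mul_sum, ← hcard, Nat.cast_smul_eq_nsmul, ← Finset.sum_const,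
        ← Finset.sum_add_distrib, ← Finset.sum_add_distrib]
      refine Finset.sum_congr rfl fun j hj' => ?_
      have h := congrArg (pderiv (vz, j)) (hj j hj')
      simp only [map_add, pderiv_mul, hP _ j hj', pderiv_X_self] at h
      linear_combination h
    -- the eigenvalue of `G` is above its degree as well
    have hlap := innerD_split h01 vz vz F
    rw [h2, ← hG] at hlap
    have heulz := euler_of_mem_homog hG1 vz
    rw [euler, skewOp_split h01 _ _ hDzG] at heulz
    have heulu := euler_of_mem_homog hG1 u
    rw [euler, skewOp_split h01 _ _ hDG] at heulu
    simp only [Pi.add_apply, Pi.single_eq_same, Pi.single_eq_of_ne hu, Pi.single_eq_of_ne hu.symm,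
      zero_add, add_zero, Int.cast_natCast, Int.cast_one] at heulz heulu
    refine eq_zero_of_perp_euler (i₀ := i₀) (i₁ := i₁) vz u hG1 (n := 2 * k + m - 1)
      (by simp [hu, hu.symm]; omega) ?_
    push_cast
    have h6 := congrArg (fun q => isoCoord i₀ i₁ u * q) hsplit
    have h7 := congrArg (fun q => isoCoord i₀ i₁ vz * q) hlap
    simp only [mul_zero, mul_add, mul_smul_comm] at h6 h7
    linear_combination (norm := module) (2 : ℂ) • heulz + heulu + hsum' + h6 + h7

/-- The highest weight vector `ζ_z^k (ζ_z u_j - ζ_u z_j)` of `simpHarm m u (k + 1) 1`, where `ζ`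
denotes the isotropic coordinates. -/
noncomputable def hwVec (i₀ i₁ : Fin m) (u : Fin 3) (k : ℕ) (j : Fin m) : Poly m :=
  isoCoord i₀ i₁ vz ^ k * (isoCoord i₀ i₁ vz * X (u, j) - isoCoord i₀ i₁ u * X (vz, j))

/-- The simplicial harmonics annihilated by the raising operators are the linear combinations of
the polynomials `hwVec`. -/
theorem exists_eq_sum_hwVec {i₀ i₁ : Fin m} (h01 : i₀ ≠ i₁) (hm : 4 ≤ m) {u : Fin 3}
    (hu : u ≠ vz) (k : ℕ) {F : Poly m} (hF : F ∈ simpHarm m u ((k + 1 : ℕ) : ℤ) 1)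
    (hraise : ∀ j ∈ perp i₀ i₁, raise i₀ i₁ j F = 0) :
    ∃ c : Fin m → ℂ, F = ∑ j ∈ perp i₀ i₁, c j • hwVec i₀ i₁ u k j := by
  obtain ⟨hDu, hDz⟩ := isoDer_eq_zero_of_mem_simpHarm h01 hm hu (k + 1) F hF hraise
  obtain ⟨h1, -, -, -, h5⟩ := mem_simpHarm_iff.1 hF
  have hx : ∀ w, w ≠ u → w ≠ vz → ∀ i, pderiv (w, i) F = 0 := fun w hw hw' i =>
    pderiv_eq_zero_of_mem_homog h1 (by simp [hw, hw']) i
  have hdeg : ∀ i l, pderiv (u, i) (pderiv (u, l) F) = 0 := fun i l =>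
    pderiv_eq_zero_of_mem_homog (d := Pi.single vz ((k + 1 : ℕ) : ℤ))
      (pderiv_mem_homog h1 u l rfl) (by simp [hu]) i
  have hf : ∀ l ∈ perp i₀ i₁, ∃ c : ℂ, pderiv (u, l) F = c • isoCoord i₀ i₁ vz ^ (k + 1) := by
    intro l hl
    refine exists_eq_smul_isoCoord_pow h01 vz (k + 1) _ (pderiv_mem_homog h1 u l rfl)
      (by rw [← pderiv_isoDer, hDz, map_zero]) fun j hj => ?_
    have h := hraise j hj
    rw [raise_apply_of_two i₀ i₁ j hu hx, hDu, hDz] at h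
    have h' := congrArg (pderiv (u, l)) h
    simp only [mul_zero, sub_zero, map_add, pderiv_mul,
      pderiv_isoCoord (mem_perp.1 hl).1 (mem_perp.1 hl).2, zero_mul, zero_add, hdeg,
      map_zero] at h'
    rw [pderiv_comm]
    exact (mul_eq_zero.1 h').resolve_left (isoCoord_ne_zero h01 vz)
  choose! c hc using hf
  refine ⟨c, mul_left_cancel₀ (isoCoord_ne_zero h01 vz) ?_⟩
  have heul := euler_of_mem_homog h1 u
  rw [euler, skewOp_split h01 _ _ hDu] at heul
  simp only [Pi.add_apply, Pi.single_eq_same, Pi.single_eq_of_ne hu, zero_add, Int.cast_one,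
    one_smul] at heul
  rw [skewOp_split h01 _ _ hDu] at h5
  have hsum : ∑ j ∈ perp i₀ i₁, isoCoord i₀ i₁ vz * (c j • hwVec i₀ i₁ u k j) =
      isoCoord i₀ i₁ vz * ∑ j ∈ perp i₀ i₁, X (u, j) * pderiv (u, j) F -
        isoCoord i₀ i₁ u * ∑ j ∈ perp i₀ i₁, X (vz, j) * pderiv (u, j) F := by
    rw [Finset.mul_sum, Finset.mul_sum, ← Finset.sum_sub_distrib]
    refine Finset.sum_congr rfl fun j hj => ?_
    rw [hc j hj, hwVec, smul_eq_C_mul, smul_eq_C_mul]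
    ring
  rw [Finset.mul_sum, hsum]
  have h6 := congrArg (fun q => isoCoord i₀ i₁ vz * q) heul
  have h7 := congrArg (fun q => isoCoord i₀ i₁ u * q) h5
  simp only [smul_eq_C_mul] at h6 h7
  linear_combination h7 - h6

/-! ### Irreducibility of the spaces of harmonics -/

theorem isoCoord_mul_mem_homog {i₀ i₁ : Fin m} {d d' : Fin 3 → ℤ} {p : Poly m}
    (hp : p ∈ homog m d) (u : Fin 3) (h : d' = d + Pi.single u 1) :
    isoCoord i₀ i₁ u * p ∈ homog m d' := by
  rw [isoCoord, add_mul, mul_assoc, ← smul_eq_C_mul]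
  exact Submodule.add_mem _ (X_mul_mem_homog hp u _ h)
    (Submodule.smul_mem _ _ (X_mul_mem_homog hp u _ h))

theorem one_mem_homog : (1 : Poly m) ∈ homog m 0 := isWeightedHomogeneous_one _ _

theorem isoCoord_pow_mem_homog (i₀ i₁ : Fin m) (u : Fin 3) (k : ℕ) :
    isoCoord i₀ i₁ u ^ k ∈ homog m (Pi.single u (k : ℤ)) := by
  induction k with
  | zero => simpa using one_mem_homog
  | succ k ih =>
    rw [pow_succ']
    exact isoCoord_mul_mem_homog ih u (by rw [← Pi.single_add, Nat.cast_succ])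

theorem isoDer_isoCoord_pow {i₀ i₁ : Fin m} (h01 : i₀ ≠ i₁) (u v : Fin 3) (k : ℕ) :
    isoDer i₀ i₁ u (isoCoord i₀ i₁ v ^ k) = 0 := by
  rw [Derivation.leibniz_pow, isoDer_isoCoord h01, smul_zero, smul_zero]

theorem pderiv_isoCoord_pow {i₀ i₁ j : Fin m} (hj : j ∈ perp i₀ i₁) (u v : Fin 3) (k : ℕ) :
    pderiv (u, j) (isoCoord i₀ i₁ v ^ k) = 0 := by
  rw [Derivation.leibniz_pow, pderiv_isoCoord (mem_perp.1 hj).1 (mem_perp.1 hj).2, smul_zero,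
    smul_zero]

theorem isoCoord_pow_mem_harm {i₀ i₁ : Fin m} (h01 : i₀ ≠ i₁) (k : ℕ) :
    isoCoord i₀ i₁ vz ^ k ∈ harm m k := by
  refine mem_harm_iff.2 ⟨isoCoord_pow_mem_homog i₀ i₁ vz k, ?_⟩
  rw [innerD_split h01, isoDer_isoCoord_pow h01, map_zero, add_zero, smul_zero, zero_add]
  exact Finset.sum_eq_zero fun j hj => by rw [pderiv_isoCoord_pow hj, map_zero]

theorem finiteDimensional_harm (k : ℤ) : FiniteDimensional ℂ (harm m k) :=
  finite_of_le_homog fun _ h => h.1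

theorem finiteDimensional_simpHarm (u : Fin 3) (k l : ℤ) :
    FiniteDimensional ℂ (simpHarm m u k l) :=
  finite_of_le_homog fun _ h => (mem_simpHarm_iff.1 h).1

/-- The highest weight vector of `H_k` is the `k`-th power of the isotropic coordinate. -/
theorem soIrreducible_harm (hm : 3 ≤ m) (k : ℕ) : SoIrreducible (harm m k) := by
  obtain ⟨i₀, i₁, h01⟩ : ∃ i₀ i₁ : Fin m, i₀ ≠ i₁ :=
    ⟨⟨0, by omega⟩, ⟨1, by omega⟩, by simp⟩
  have := finiteDimensional_harm (m := m) k
  refine soIrreducible_of_forall_mem (soInvariant_harm k) (isoCoord_pow_mem_harm h01 k)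
    (pow_ne_zero _ (isoCoord_ne_zero h01 vz)) fun U hU hUinv hne => ?_
  obtain ⟨p, hp, hp0, hraise⟩ := hUinv.exists_raise_eq_zero hne h01
  have hr : ∀ j ∈ perp i₀ i₁, raise i₀ i₁ j p = 0 := fun j hj =>
    hraise j (mem_perp.1 hj).1 (mem_perp.1 hj).2
  have hD := isoDer_eq_zero_of_mem_harm h01 hm k p (hU hp) hr
  have hpH := (mem_harm_iff.1 (hU hp)).1
  obtain ⟨c, hc⟩ := exists_eq_smul_isoCoord_pow h01 vz k p hpH hD fun j hj => by
    have h := hr j hj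
    have hx : ∀ i, pderiv (vx, i) p = 0 := fun i =>
      pderiv_eq_zero_of_mem_homog hpH (by simp [show vx ≠ vz by decide]) i
    rw [raise_apply_of_two i₀ i₁ j (show vx ≠ vz by decide) fun w _ hw i =>
      pderiv_eq_zero_of_mem_homog hpH (by simp [hw]) i, hD, isoDer_apply, hx, hx, hx] at h
    simpa [isoCoord_ne_zero h01] using h
  have hc0 : c ≠ 0 := by
    rintro rfl
    exact hp0 (by rw [hc, zero_smul])
  rw [hc] at hp
  exact (U.smul_mem_iff hc0).1 hp

theorem isoDer_hwVec {i₀ i₁ : Fin m} (h01 : i₀ ≠ i₁) (u v : Fin 3) (k : ℕ) {j : Fin m}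
    (hj : j ∈ perp i₀ i₁) : isoDer i₀ i₁ v (hwVec i₀ i₁ u k j) = 0 := by
  have h : ∀ w, isoDer i₀ i₁ v (X (w, j)) = 0 := fun w => by
    simp [isoDer_apply, (mem_perp.1 hj).1, (mem_perp.1 hj).2]
  simp [hwVec, Derivation.leibniz, isoDer_isoCoord_pow h01, isoDer_isoCoord h01, h]

theorem pderiv_hwVec {i₀ i₁ : Fin m} {u : Fin 3} (v : Fin 3) (k : ℕ)
    {j l : Fin m} (hl : l ∈ perp i₀ i₁) :
    pderiv (v, l) (hwVec i₀ i₁ u k j) = if l = j then isoCoord i₀ i₁ vz ^ k *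
      ((if v = u then isoCoord i₀ i₁ vz else 0) - if v = vz then isoCoord i₀ i₁ u else 0)
        else 0 := by
  simp only [hwVec, pderiv_mul, map_sub, pderiv_isoCoord_pow hl,
    pderiv_isoCoord (mem_perp.1 hl).1 (mem_perp.1 hl).2, pderiv_X, Pi.single_apply, Prod.mk.injEq]
  by_cases h : l = j
  · simp [h, eq_comm]
  · simp [h, Ne.symm h]

theorem hwVec_mem_simpHarm {i₀ i₁ : Fin m} (h01 : i₀ ≠ i₁) {u : Fin 3} (hu : u ≠ vz) (k : ℕ)
    {j : Fin m} (hj : j ∈ perp i₀ i₁) :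
    hwVec i₀ i₁ u k j ∈ simpHarm m u ((k + 1 : ℕ) : ℤ) 1 := by
  have hD : ∀ v w, innerD v w (hwVec i₀ i₁ u k j) = 0 := by
    intro v w
    rw [innerD_split h01, isoDer_hwVec h01 _ _ _ hj, isoDer_hwVec h01 _ _ _ hj, map_zero, map_zero,
      add_zero, smul_zero, zero_add]
    refine Finset.sum_eq_zero fun l hl => ?_
    have hP : ∀ a, pderiv (v, l) (isoCoord i₀ i₁ a) = 0 :=
      pderiv_isoCoord (mem_perp.1 hl).1 (mem_perp.1 hl).2 v
    rw [pderiv_hwVec w k hl]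
    split_ifs <;> simp [pderiv_isoCoord_pow hl, hP]
  refine mem_simpHarm_iff.2 ⟨?_, hD _ _, hD _ _, hD _ _, ?_⟩
  · rw [hwVec, mul_sub, mul_left_comm, mul_left_comm _ (isoCoord i₀ i₁ u), mul_comm _ (X (u, j)),
      mul_comm _ (X (vz, j))]
    have h := isoCoord_pow_mem_homog i₀ i₁ vz k
    refine Submodule.sub_mem _
      (isoCoord_mul_mem_homog (X_mul_mem_homog h u j rfl) vz
        (by rw [Nat.cast_succ, Pi.single_add, add_right_comm]))
      (isoCoord_mul_mem_homog (X_mul_mem_homog h vz j rfl) u (by rw [Nat.cast_succ, Pi.single_add]))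
  · rw [skewOp_split h01 _ _ (isoDer_hwVec h01 _ _ _ hj), Finset.sum_congr rfl fun l hl => by
      rw [pderiv_hwVec u k hl]]
    have h1 : ∀ w, isoDerConj i₀ i₁ u (X (w, j)) = 0 := fun w => by
      simp [isoDerConj_apply, (mem_perp.1 hj).1, (mem_perp.1 hj).2]
    simp [hwVec, h1, hj, hu, hu.symm, isoDerConj_isoCoord h01, Derivation.leibniz,
      Derivation.leibniz_pow, smul_eq_C_mul]
    have h2 : (C 2⁻¹ : Poly m) * 2 = 1 := by
      rw [← map_ofNat (C : ℂ →+* Poly m) 2, ← C_mul]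
      norm_num
    linear_combination (-(isoCoord i₀ i₁ vz ^ k * isoCoord i₀ i₁ vz * X (vz, j))) * h2

theorem hwVec_ne_zero {i₀ i₁ : Fin m} (h01 : i₀ ≠ i₁) {u : Fin 3} (hu : u ≠ vz) (k : ℕ)
    {j : Fin m} (hj : j ∈ perp i₀ i₁) : hwVec i₀ i₁ u k j ≠ 0 := by
  intro h
  have h' := congrArg (pderiv (u, j)) h
  rw [pderiv_hwVec u k hj] at h'
  simp [hu, isoCoord_ne_zero h01] at h'

theorem rot_isoCoord {i₀ i₁ a b : Fin m} (ha : a ∈ perp i₀ i₁) (hb : b ∈ perp i₀ i₁) (u : Fin 3) :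
    rot a b (isoCoord i₀ i₁ u) = 0 := by
  rw [mem_perp] at ha hb
  rw [isoCoord, ← smul_eq_C_mul, map_add, map_smul, rot_X, rot_X]
  simp [ha.1.symm, ha.2.symm, hb.1.symm, hb.2.symm]

theorem rot_hwVec {i₀ i₁ a b : Fin m} (ha : a ∈ perp i₀ i₁) (hb : b ∈ perp i₀ i₁) (u : Fin 3)
    (k : ℕ) (j : Fin m) : rot a b (hwVec i₀ i₁ u k j) =
      (if j = b then hwVec i₀ i₁ u k a else 0) - if j = a then hwVec i₀ i₁ u k b else 0 := by
  have h : rot a b (isoCoord i₀ i₁ vz ^ k) = 0 := by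
    rw [← rotDer_apply, Derivation.leibniz_pow, rotDer_apply, rot_isoCoord ha hb, smul_zero,
      smul_zero]
  simp only [hwVec, rot_mul, map_sub, h, rot_isoCoord ha hb, rot_X]
  split_ifs <;> ring

/-- The vectors annihilated by the raising operators form the vector representation of the
rotations in the coordinates `perp i₀ i₁`; as it is irreducible, a nonzero invariant subspace
contains all of them. -/
theorem soIrreducible_simpHarm (hm : 5 ≤ m) {u : Fin 3} (hu : u ≠ vz) (k : ℕ) :
    SoIrreducible (simpHarm m u ((k + 1 : ℕ) : ℤ) 1) := by
  obtain ⟨i₀, i₁, h01⟩ : ∃ i₀ i₁ : Fin m, i₀ ≠ i₁ :=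
    ⟨⟨0, by omega⟩, ⟨1, by omega⟩, by simp⟩
  have hcard := card_perp h01
  obtain ⟨n, hn⟩ : (perp i₀ i₁).Nonempty := Finset.card_pos.1 (by omega)
  have := finiteDimensional_simpHarm (m := m) u ((k + 1 : ℕ) : ℤ) 1
  refine soIrreducible_of_forall_mem (soInvariant_simpHarm _ _ _) (hwVec_mem_simpHarm h01 hu k hn)
    (hwVec_ne_zero h01 hu k hn) fun U hU hUinv hne => ?_
  obtain ⟨F, hF, hF0, hraise⟩ := hUinv.exists_raise_eq_zero hne h01
  obtain ⟨c, hc⟩ := exists_eq_sum_hwVec h01 (by omega) hu k (hU hF) fun j hj =>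
    hraise j (mem_perp.1 hj).1 (mem_perp.1 hj).2
  obtain ⟨b, hb, hcb⟩ : ∃ b ∈ perp i₀ i₁, c b ≠ 0 := by
    by_contra! h
    exact hF0 (by rw [hc, Finset.sum_eq_zero fun j hj => by rw [h j hj, zero_smul]])
  -- two further indices in `perp`, used to isolate the `b`-th coefficient by two rotations
  obtain ⟨j, hj, hjb⟩ : ∃ j ∈ perp i₀ i₁, j ≠ b :=
    Finset.exists_mem_ne (by omega) b
  obtain ⟨l, hl, hlbj⟩ : ∃ l ∈ perp i₀ i₁, l ∉ ({b, j} : Finset (Fin m)) :=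
    Finset.exists_mem_notMem_of_card_lt_card (by
      have := Finset.card_le_two (a := b) (b := j)
      omega)
  simp only [Finset.mem_insert, Finset.mem_singleton, not_or] at hlbj
  have h1 : rot j b F = c b • hwVec i₀ i₁ u k j - c j • hwVec i₀ i₁ u k b := by
    rw [hc, map_sum]
    simp only [map_smul, rot_hwVec hj hb, smul_sub, Finset.sum_sub_distrib, smul_ite, smul_zero,
      Finset.sum_ite_eq', hb, hj, if_true]
  have h2 : rot l j (rot j b F) = c b • hwVec i₀ i₁ u k l := by
    rw [h1, map_sub, map_smul, map_smul, rot_hwVec hl hj, rot_hwVec hl hj]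
    simp [hjb.symm, Ne.symm hlbj.1, Ne.symm hlbj.2]
  have h3 : hwVec i₀ i₁ u k l ∈ U := by
    rw [← U.smul_mem_iff hcb, ← h2]
    exact hUinv _ _ _ (hUinv _ _ _ hF)
  by_cases hnl : l = n
  · rwa [← hnl]
  · have h4 := hUinv n l _ h3
    rwa [rot_hwVec hn hl, if_pos rfl, if_neg hnl, sub_zero] at h4

/-! ### Commutators of the invariant operators -/

theorem innerD_skewOp (a b u w : Fin 3) (p : Poly m) :
    innerD a b (skewOp u w p) = (if b = u then innerD a w p else 0) +
      (if a = u then innerD w b p else 0) + skewOp u w (innerD a b p) := by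
  rw [innerD_apply, innerD_apply a b]
  simp only [pderiv_skewOp, map_add, map_sum, Finset.sum_add_distrib, apply_ite (pderiv _),
    map_zero]
  by_cases hb : b = u <;> by_cases ha : a = u <;> simp [ha, hb, innerD_apply, add_assoc]

theorem innerD_innerMul (a b u w : Fin 3) (p : Poly m) :
    innerD a b (innerMul u w p) =
      (if b = u then (if a = w then (m : ℂ) • p else 0) + skewOp w a p else 0) +
      (if b = w then (if a = u then (m : ℂ) • p else 0) + skewOp u a p else 0) +
      (if a = u then skewOp w b p else 0) + (if a = w then skewOp u b p else 0) +
        innerMul u w (innerD a b p) := by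
  rw [innerD_apply, innerD_apply a b]
  simp only [pderiv_innerMul, map_add, map_sum, Finset.sum_add_distrib, apply_ite (pderiv _),
    map_zero, pderiv_X_mul, if_true]
  have h : ∀ q : Poly m, (m : ℂ) • q = ∑ _j : Fin m, q := fun q => by
    rw [Finset.sum_const, Finset.card_univ, Fintype.card_fin, Nat.cast_smul_eq_nsmul]
  by_cases hbu : b = u <;> by_cases hbw : b = w <;> by_cases hau : a = u <;>
    by_cases haw : a = w <;> 
    simp [hbu, hbw, hau, haw, skewOp_apply, h, Finset.sum_add_distrib, add_assoc]

theorem innerD_innerD (a b u w : Fin 3) (p : Poly m) :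
    innerD a b (innerD u w p) = innerD u w (innerD a b p) := by
  rw [innerD_apply, innerD_apply a b]
  simp only [pderiv_innerD, map_sum]

theorem skewOp_skewOp (a b u w : Fin 3) (p : Poly m) :
    skewOp a b (skewOp u w p) = (if b = u then skewOp a w p else 0) -
      (if w = a then skewOp u b p else 0) + skewOp u w (skewOp a b p) := by
  rw [skewOp_apply u w, skewOp_apply u w (skewOp a b p)]
  simp only [map_sum, skewOp_X_mul, pderiv_skewOp, mul_add, Finset.sum_add_distrib]
  by_cases hb : b = u <;> by_cases hw : w = a <;> simp [hb, hw, skewOp_apply]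
  abel

/-! ### Direct sums -/

theorem iSupIndep_iff_forall_sum {n : ℕ} {f : Fin n → Submodule ℂ (Poly m)} :
    iSupIndep f ↔ ∀ v : Fin n → Poly m, (∀ i, v i ∈ f i) → ∑ i, v i = 0 → ∀ i, v i = 0 := by
  rw [iSupIndep_iff_finsetSum_eq_zero_imp_eq_zero]
  constructor
  · intro h v hv hs i
    exact h Finset.univ v (fun i _ => hv i) hs i (Finset.mem_univ i)
  · intro h s v hv hs i hi
    have := h (fun i => if i ∈ s then v i else 0)
      (fun i => by
        by_cases hi : i ∈ s
        · simpa [hi] using hv i hi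
        · simp [hi])
      (by simpa using hs) i
    simpa [hi] using this

theorem IsDirectSum.map {n : ℕ} {W : Submodule ℂ (Poly m)} {f : Fin n → Submodule ℂ (Poly m)}
    (h : IsDirectSum W f) {T : Module.End ℂ (Poly m)} (hT : ∀ p ∈ W, T p = 0 → p = 0) :
    IsDirectSum (W.map T) fun i => (f i).map T := by
  refine ⟨iSupIndep_iff_forall_sum.2 fun v hv hs i => ?_, by rw [← h.2, Submodule.map_iSup]⟩
  choose w hw hwv using hv
  have hsum : ∑ i, w i = 0 := by
    refine hT _ (Submodule.sum_mem _ fun i _ => ?_) (by rw [map_sum, ← hs]; simp only [hwv])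
    rw [← h.2]
    exact Submodule.mem_iSup_of_mem i (hw i)
  rw [← hwv, iSupIndep_iff_forall_sum.1 h.1 w hw hsum i, map_zero]

theorem isDirectSum_two {W A B : Submodule ℂ (Poly m)} (hA : A ≤ W) (hB : B ≤ W)
    (hind : ∀ a ∈ A, ∀ b ∈ B, a + b = 0 → a = 0 ∧ b = 0)
    (hW : ∀ w ∈ W, ∃ a ∈ A, ∃ b ∈ B, w = a + b) : IsDirectSum W ![A, B] := by
  refine ⟨iSupIndep_iff_forall_sum.2 fun v hv hs => ?_, le_antisymm (iSup_le ?_) fun w hw => ?_⟩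
  · rw [Fin.sum_univ_two] at hs
    have := hind _ (hv 0) _ (hv 1) hs
    rw [Fin.forall_fin_two]
    exact this
  · rw [Fin.forall_fin_two]
    exact ⟨hA, hB⟩
  · obtain ⟨a, ha, b, hb, rfl⟩ := hW w hw
    exact Submodule.add_mem _ (Submodule.mem_iSup_of_mem (p := ![A, B]) 0 ha)
      (Submodule.mem_iSup_of_mem (p := ![A, B]) 1 hb)

theorem isDirectSum_three {W A B D : Submodule ℂ (Poly m)} (hA : A ≤ W) (hB : B ≤ W) (hD : D ≤ W)
    (hind : ∀ a ∈ A, ∀ b ∈ B, ∀ d ∈ D, a + b + d = 0 → a = 0 ∧ b = 0 ∧ d = 0)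
    (hW : ∀ w ∈ W, ∃ a ∈ A, ∃ b ∈ B, ∃ d ∈ D, w = a + b + d) : IsDirectSum W ![A, B, D] := by
  have hall : ∀ P : Fin 3 → Prop, P 0 ∧ P 1 ∧ P 2 → ∀ i, P i := by
    rintro P ⟨h0, h1, h2⟩ i
    fin_cases i <;> assumption
  refine ⟨iSupIndep_iff_forall_sum.2 fun v hv hs => ?_, le_antisymm (iSup_le ?_) fun w hw => ?_⟩
  · rw [Fin.sum_univ_three] at hs
    exact hall _ (hind _ (hv 0) _ (hv 1) _ (hv 2) hs)
  · exact hall _ ⟨hA, hB, hD⟩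
  · obtain ⟨a, ha, b, hb, d, hd, rfl⟩ := hW w hw
    exact Submodule.add_mem _ (Submodule.add_mem _
      (Submodule.mem_iSup_of_mem (p := ![A, B, D]) 0 ha)
      (Submodule.mem_iSup_of_mem (p := ![A, B, D]) 1 hb))
      (Submodule.mem_iSup_of_mem (p := ![A, B, D]) 2 hd)

/-! ### The decomposition of the tensor product with the vector representation -/

/-- The space `(1)_u ⊗ (k)_z` consists of the polynomials of degree `(k, 1)` in `(z, u)` that are
harmonic in `z`. -/
theorem mem_tensorSpace_iff {u : Fin 3} (hu : u ≠ vz) {k : ℤ} {p : Poly m} :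
    p ∈ tensorSpace m u k ↔
      p ∈ homog m (Pi.single vz k + Pi.single u 1) ∧ innerD vz vz p = 0 := by
  constructor
  · intro hp
    suffices h : tensorSpace m u k ≤
        homog m (Pi.single vz k + Pi.single u 1) ⊓ LinearMap.ker (innerD vz vz) from h hp
    refine Submodule.span_le.2 ?_
    rintro _ ⟨j, h, hh, rfl⟩
    obtain ⟨h1, h2⟩ := mem_harm_iff.1 hh
    refine ⟨X_mul_mem_homog h1 u j rfl, ?_⟩
    change innerD vz vz _ = 0
    rw [innerD_X_mul, h2, if_neg hu.symm, mul_zero, add_zero, add_zero]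
  · rintro ⟨h1, h2⟩
    have he := euler_of_mem_homog h1 u
    rw [euler, skewOp_apply] at he
    simp only [Pi.add_apply, Pi.single_eq_same, Pi.single_eq_of_ne hu, zero_add, Int.cast_one,
      one_smul] at he
    rw [← he]
    refine Submodule.sum_mem _ fun j _ => Submodule.subset_span ⟨j, _, ?_, rfl⟩
    exact mem_harm_iff.2 ⟨pderiv_mem_homog h1 u j rfl, by rw [← pderiv_innerD, h2, map_zero]⟩

theorem harm_eq_bot {k : ℤ} (hk : k < 0) : harm m k = ⊥ :=
  (Submodule.eq_bot_iff _).2 fun _ hp => eq_zero_of_mem_homog hp.1 vz (by simpa)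

theorem tensorSpace_eq_bot {u : Fin 3} (hu : u ≠ vz) {k : ℤ} (hk : k < 0) :
    tensorSpace m u k = ⊥ :=
  (Submodule.eq_bot_iff _).2 fun _ hp =>
    eq_zero_of_mem_homog ((mem_tensorSpace_iff hu).1 hp).1 vz (by simpa [hu.symm])

theorem simpHarm_le_tensorSpace {u : Fin 3} (hu : u ≠ vz) (k : ℤ) :
    simpHarm m u k 1 ≤ tensorSpace m u k := fun _ hp =>
  (mem_tensorSpace_iff hu).2 ⟨(mem_simpHarm_iff.1 hp).1, (mem_simpHarm_iff.1 hp).2.1⟩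

/-- There are no simplicial harmonics of degree `(k, 1)` with `k ≤ 0`. -/
theorem simpHarm_eq_bot {u : Fin 3} (hu : u ≠ vz) {k : ℤ} (hk : k ≤ 0) :
    simpHarm m u k 1 = ⊥ := by
  refine (Submodule.eq_bot_iff _).2 fun p hp => ?_
  obtain ⟨h1, -, -, -, h5⟩ := mem_simpHarm_iff.1 hp
  have hz : ∀ j, pderiv (vz, j) p = 0 := fun j =>
    pderiv_eq_zero_of_mem_homog h1 (by simpa [hu.symm]) j
  have hj : ∀ j, pderiv (u, j) p = 0 := fun j => by
    have h := congrArg (pderiv (vz, j)) h5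
    rwa [pderiv_skewOp, if_pos rfl, hz, map_zero, map_zero, add_zero] at h
  have he := euler_of_mem_homog h1 u
  rw [euler, skewOp_apply] at he
  simpa [hj, hu, eq_comm] using he

section

variable {u : Fin 3} {k : ℤ} {h : Poly m}

theorem innerD_of_mem_harm (hu : u ≠ vz) (hh : h ∈ harm m k) (w : Fin 3) : innerD w u h = 0 := by
  rw [innerD_apply]
  exact Finset.sum_eq_zero fun j _ => by
    rw [pderiv_eq_zero_of_mem_homog hh.1 (by simp [hu]), map_zero]

theorem skewOp_of_mem_harm (hu : u ≠ vz) (hh : h ∈ harm m k) (w : Fin 3) : skewOp w u h = 0 := by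
  rw [skewOp_apply]
  exact Finset.sum_eq_zero fun j _ => by
    rw [pderiv_eq_zero_of_mem_homog hh.1 (by simp [hu]), mul_zero]

theorem skewOp_self_of_mem_harm (hh : h ∈ harm m k) : skewOp vz vz h = (k : ℂ) • h := by
  have he := euler_of_mem_homog hh.1 vz
  rwa [Pi.single_eq_same] at he

theorem opS_of_mem_harm (hu : u ≠ vz) (hh : h ∈ harm m k) : opS m u vz h = skewOp u vz h := by
  rw [opS, LinearMap.sub_apply, Module.End.mul_apply, Module.End.mul_apply, innerD_comm,
    innerD_of_mem_harm hu hh, map_zero, map_zero, sub_zero]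

theorem skewOp_mem_homog_of_mem_harm (hh : h ∈ harm m k) :
    skewOp u vz h ∈ homog m (Pi.single vz (k - 1) + Pi.single u 1) := by
  refine skewOp_mem_homog hh.1 u vz ?_
  rw [add_right_comm, ← Pi.single_add, sub_add_cancel]

theorem innerD_skewOp_of_mem_harm (hu : u ≠ vz) (hh : h ∈ harm m k) :
    innerD vz vz (skewOp u vz h) = 0 := by
  rw [innerD_skewOp, if_neg hu.symm, (mem_harm_iff.1 hh).2, map_zero, add_zero,
    add_zero]

/-- On harmonics in `z` the correction terms of `C_{uz}` that contain a derivative in `u` vanish. -/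
theorem opC_of_mem_harm (hu : u ≠ vz) (hh : h ∈ harm m k) :
    opC m u vz h = innerMul u vz h -
      (2 * (k : ℂ) + m - 2)⁻¹ • innerMul vz vz (skewOp u vz h) := by
  have h1 := shiftInv_of_mem_homog
    (innerMul_mem_homog (skewOp_mem_homog_of_mem_harm (u := u) hh) vz vz rfl) vz
  simp only [Pi.add_apply, Pi.single_eq_same, Pi.single_eq_of_ne hu.symm, add_zero] at h1
  simp only [opC, LinearMap.add_apply, LinearMap.sub_apply, Module.End.mul_apply, normSqMul]
  rw [innerD_comm, innerD_of_mem_harm hu hh, skewOp_of_mem_harm hu hh, map_zero, map_zero, map_zero,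
    map_zero, map_zero, map_zero, sub_zero, add_zero, h1]
  congr 3
  push_cast
  ring

theorem opS_mem_tensorSpace (hu : u ≠ vz) (hh : h ∈ harm m k) :
    opS m u vz h ∈ tensorSpace m u (k - 1) := by
  rw [opS_of_mem_harm hu hh]
  exact (mem_tensorSpace_iff hu).2
    ⟨skewOp_mem_homog_of_mem_harm hh, innerD_skewOp_of_mem_harm hu hh⟩

theorem skewOp_opS (hu : u ≠ vz) (hh : h ∈ harm m k) :
    skewOp vz u (opS m u vz h) = (k : ℂ) • h := by
  rw [opS_of_mem_harm hu hh, skewOp_skewOp, if_pos rfl, if_pos rfl, skewOp_of_mem_harm hu hh,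
    skewOp_of_mem_harm hu hh, map_zero, add_zero, sub_zero, skewOp_self_of_mem_harm hh]

theorem innerD_opS (hu : u ≠ vz) (hh : h ∈ harm m k) : innerD vz u (opS m u vz h) = 0 := by
  rw [opS_of_mem_harm hu hh, innerD_skewOp, if_pos rfl, if_neg hu.symm, innerD_of_mem_harm hu hh,
    (mem_harm_iff.1 hh).2, map_zero, add_zero, add_zero]

theorem two_mul_add_sub_ne_zero (hm : 3 ≤ m) (hk : 0 ≤ k) : 2 * (k : ℂ) + m - 2 ≠ 0 := by
  have : (2 * k + m - 2 : ℤ) ≠ 0 := by omega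
  exact_mod_cast this

theorem opC_mem_tensorSpace (hm : 3 ≤ m) (hu : u ≠ vz) (hh : h ∈ harm m k) :
    opC m u vz h ∈ tensorSpace m u (k + 1) := by
  rcases lt_or_ge k 0 with hk | hk
  · rw [harm_eq_bot hk, Submodule.mem_bot] at hh
    rw [hh, map_zero]
    exact Submodule.zero_mem _
  rw [opC_of_mem_harm hu hh]
  refine (mem_tensorSpace_iff hu).2 ⟨Submodule.sub_mem _ (innerMul_mem_homog hh.1 u vz ?_)
    (Submodule.smul_mem _ _ (innerMul_mem_homog (skewOp_mem_homog_of_mem_harm hh) vz vz ?_)), ?_⟩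
  · rw [Pi.single_add]
  · rw [Pi.single_add, Pi.single_sub]
    abel
  · have he := euler_of_mem_homog (skewOp_mem_homog_of_mem_harm (u := u) hh) vz
    simp only [Pi.add_apply, Pi.single_eq_same, Pi.single_eq_of_ne hu.symm, add_zero, euler] at he
    simp only [map_sub, map_smul, innerD_innerMul, if_neg hu.symm, if_true,
      innerD_skewOp_of_mem_harm hu hh, (mem_harm_iff.1 hh).2, map_zero, add_zero, zero_add, he]
    push_cast
    match_scalars
    field_simp [two_mul_add_sub_ne_zero hm hk]
    ring

/-- The scalar by which `⟨∂_z, ∂_u⟩ C_{uz}` acts on harmonics of degree `k`. -/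
noncomputable def divScalar (m : ℕ) (k : ℤ) : ℂ := m + k - 2 * k * (2 * (k : ℂ) + m - 2)⁻¹

theorem divScalar_ne_zero (hm : 3 ≤ m) (hk : 0 ≤ k) : divScalar m k ≠ 0 := by
  have h0 := two_mul_add_sub_ne_zero hm hk
  intro h
  have h1 : ((m : ℂ) + k) * (2 * (k : ℂ) + m - 2) - 2 * k = 0 := by
    have h2 := mul_inv_cancel₀ h0
    rw [divScalar] at h
    linear_combination (2 * (k : ℂ) + m - 2) * h + 2 * k * h2
  have h2 : ((m : ℤ) + k) * (2 * k + m - 2) - 2 * k = 0 := by exact_mod_cast h1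
  nlinarith [mul_nonneg hk hk]

theorem innerD_opC (hu : u ≠ vz) (hh : h ∈ harm m k) :
    innerD vz u (opC m u vz h) = divScalar m k • h := by
  have h1 : innerD vz u (skewOp u vz h) = 0 := by
    rw [← opS_of_mem_harm hu hh, innerD_opS hu hh]
  have h2 : skewOp vz u (skewOp u vz h) = (k : ℂ) • h := by
    rw [← opS_of_mem_harm hu hh, skewOp_opS hu hh]
  rw [opC_of_mem_harm hu hh]
  simp only [map_sub, map_smul, innerD_innerMul, if_neg hu.symm, if_neg hu, if_true, h1, h2,
    innerD_of_mem_harm hu hh, skewOp_of_mem_harm hu hh, skewOp_self_of_mem_harm hh, map_zero,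
    add_zero, zero_add, divScalar]
  module

theorem soEmbedding_opS (hu : u ≠ vz) (hk : k ≠ 0) : SoEmbedding (opS m u vz) (harm m k) := by
  refine ⟨fun p hp h0 => ?_, fun a b p hp => ?_⟩
  · have h := skewOp_opS hu hp
    rw [h0, map_zero, eq_comm, smul_eq_zero] at h
    exact h.resolve_left (by exact_mod_cast hk)
  · rw [opS_of_mem_harm hu hp, opS_of_mem_harm hu (soInvariant_harm k a b p hp), rot_skewOp]

theorem soEmbedding_opC (hm : 3 ≤ m) (hu : u ≠ vz) (k : ℤ) :
    SoEmbedding (opC m u vz) (harm m k) := by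
  refine ⟨fun p hp h0 => ?_, fun a b p hp => ?_⟩
  · rcases lt_or_ge k 0 with hk | hk
    · rwa [harm_eq_bot hk, Submodule.mem_bot] at hp
    · have h := innerD_opC hu hp
      rw [h0, map_zero, eq_comm, smul_eq_zero] at h
      exact h.resolve_left (divScalar_ne_zero hm hk)
  · rw [opC_of_mem_harm hu hp, opC_of_mem_harm hu (soInvariant_harm k a b p hp), map_sub, map_smul,
      rot_innerMul, rot_innerMul, rot_skewOp]

theorem map_opS_le_tensorSpace (hu : u ≠ vz) (k : ℤ) :
    (harm m (k + 1)).map (opS m u vz) ≤ tensorSpace m u k := by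
  rintro _ ⟨h, hh, rfl⟩
  simpa using opS_mem_tensorSpace hu hh

theorem map_opC_le_tensorSpace (hm : 3 ≤ m) (hu : u ≠ vz) (k : ℤ) :
    (harm m (k - 1)).map (opC m u vz) ≤ tensorSpace m u k := by
  rintro _ ⟨h, hh, rfl⟩
  simpa using opC_mem_tensorSpace hm hu hh

theorem innerD_mem_harm_of_mem_tensorSpace (hu : u ≠ vz) {p : Poly m}
    (hp : p ∈ tensorSpace m u k) : innerD vz u p ∈ harm m (k - 1) := by
  obtain ⟨hp1, hp2⟩ := (mem_tensorSpace_iff hu).1 hp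
  refine mem_harm_iff.2 ⟨innerD_mem_homog hp1 vz u ?_, by rw [innerD_innerD, hp2, map_zero]⟩
  rw [← Pi.single_add, sub_add_cancel]

theorem skewOp_mem_harm_of_mem_tensorSpace (hu : u ≠ vz) {p : Poly m}
    (hp : p ∈ tensorSpace m u k) (h0 : innerD vz u p = 0) : skewOp vz u p ∈ harm m (k + 1) := by
  obtain ⟨hp1, hp2⟩ := (mem_tensorSpace_iff hu).1 hp
  refine mem_harm_iff.2 ⟨skewOp_mem_homog hp1 vz u ?_, ?_⟩
  · rw [Pi.single_add, add_right_comm]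
  · rw [innerD_skewOp, if_pos rfl, if_pos rfl, innerD_comm u, h0, hp2, map_zero, add_zero, add_zero]

/-- The component in `C_{uz} H_{k-1}` is determined by the divergence `⟨∂_z, ∂_u⟩ p`. -/
theorem exists_innerD_sub_opC_eq_zero (hm : 3 ≤ m) (hu : u ≠ vz) {p : Poly m}
    (hp : p ∈ tensorSpace m u k) :
    ∃ g ∈ harm m (k - 1), innerD vz u (p - opC m u vz g) = 0 := by
  have hdiv := innerD_mem_harm_of_mem_tensorSpace hu hp
  rcases lt_or_ge (k - 1) 0 with hk | hk
  · refine ⟨0, Submodule.zero_mem _, ?_⟩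
    rwa [map_zero, sub_zero, ← Submodule.mem_bot ℂ, ← harm_eq_bot hk]
  · refine ⟨(divScalar m (k - 1))⁻¹ • innerD vz u p, Submodule.smul_mem _ _ hdiv, ?_⟩
    rw [map_sub, map_smul, map_smul, innerD_opC hu hdiv, smul_smul,
      inv_mul_cancel₀ (divScalar_ne_zero hm hk), one_smul, sub_self]

/-- Among the polynomials without divergence, the component in `S_{uz} H_{k+1}` is determined by
`⟨z, ∂_u⟩ p`, and what remains is a simplicial harmonic. -/
theorem exists_sub_opS_mem_simpHarm (hu : u ≠ vz) (hk : 0 ≤ k) {p : Poly m}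
    (hp : p ∈ tensorSpace m u k) (h0 : innerD vz u p = 0) :
    ∃ h ∈ harm m (k + 1), p - opS m u vz h ∈ simpHarm m u k 1 := by
  have hk1 : ((k + 1 : ℤ) : ℂ) ≠ 0 := by
    have : k + 1 ≠ 0 := by omega
    exact_mod_cast this
  have hmul := skewOp_mem_harm_of_mem_tensorSpace hu hp h0
  have hh := Submodule.smul_mem _ (((k + 1 : ℤ) : ℂ))⁻¹ hmul
  refine ⟨_, hh, ?_⟩
  obtain ⟨h1, h2⟩ := (mem_tensorSpace_iff hu).1
    (Submodule.sub_mem _ hp (map_opS_le_tensorSpace hu k (Submodule.mem_map_of_mem hh)))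
  refine mem_simpHarm_iff.2 ⟨h1, h2, ?_, ?_, ?_⟩
  · rw [innerD_apply]
    exact Finset.sum_eq_zero fun j _ => pderiv_eq_zero_of_mem_homog
      (d := Pi.single vz k) (pderiv_mem_homog h1 u j rfl) (by simp [hu]) j
  · rw [map_sub, h0, innerD_opS hu hh, sub_zero]
  · rw [map_sub, skewOp_opS hu hh, smul_smul, mul_inv_cancel₀ hk1, one_smul, sub_self]

theorem isDirectSum_tensorSpace (hm : 3 ≤ m) (hu : u ≠ vz) (k : ℤ) :
    IsDirectSum (tensorSpace m u k) ![simpHarm m u k 1, (harm m (k + 1)).map (opS m u vz),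
      (harm m (k - 1)).map (opC m u vz)] := by
  refine isDirectSum_three (simpHarm_le_tensorSpace hu k) (map_opS_le_tensorSpace hu k)
    (map_opC_le_tensorSpace hm hu k) ?_ ?_
  · rintro F hF _ ⟨h, hh, rfl⟩ _ ⟨g, hg, rfl⟩ hsum
    rw [SetLike.mem_coe] at hh hg
    obtain ⟨-, -, -, h4, h5⟩ := mem_simpHarm_iff.1 hF
    have hC0 : opC m u vz g = 0 := by
      rcases lt_or_ge (k - 1) 0 with hk | hk
      · rw [harm_eq_bot hk, Submodule.mem_bot] at hg
        rw [hg, map_zero]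
      · have h := congrArg (innerD vz u) hsum
        rw [map_add, map_add, h4, innerD_opS hu hh, innerD_opC hu hg, map_zero, zero_add, zero_add,
          smul_eq_zero] at h
        rw [h.resolve_left (divScalar_ne_zero hm hk), map_zero]
    have hS0 : opS m u vz h = 0 := by
      rw [hC0, add_zero] at hsum
      have h' := congrArg (skewOp vz u) hsum
      rw [map_add, h5, skewOp_opS hu hh, map_zero, zero_add, smul_eq_zero] at h'
      rcases h' with h' | h'
      · -- for `k = -1` the whole space vanishes
        have hk : k + 1 = 0 := by exact_mod_cast h'
        have hmem := map_opS_le_tensorSpace hu k (Submodule.mem_map_of_mem hh)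
        rwa [tensorSpace_eq_bot hu (by omega), Submodule.mem_bot] at hmem
      · rw [h', map_zero]
    rw [hC0, hS0, add_zero, add_zero] at hsum
    exact ⟨hsum, hS0, hC0⟩
  · intro p hp
    rcases lt_or_ge k 0 with hk | hk
    · rw [tensorSpace_eq_bot hu hk, Submodule.mem_bot] at hp
      exact ⟨0, Submodule.zero_mem _, 0, Submodule.zero_mem _, 0, Submodule.zero_mem _,
        by simp [hp]⟩
    obtain ⟨g, hg, hpg⟩ := exists_innerD_sub_opC_eq_zero hm hu hp
    obtain ⟨h, hh, hF⟩ := exists_sub_opS_mem_simpHarm hu hk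
      (Submodule.sub_mem _ hp (map_opC_le_tensorSpace hm hu k (Submodule.mem_map_of_mem hg))) hpg
    exact ⟨_, hF, _, Submodule.mem_map_of_mem hh, _, Submodule.mem_map_of_mem hg, by abel⟩

end

/-! ### The kernel of `L` -/

theorem forall_vectorVar {P : Fin 3 → Prop} (hx : P vx) (hy : P vy) (hz : P vz) (u : Fin 3) :
    P u := by
  fin_cases u <;> assumption

@[simp]
theorem single_vx_vy (k : ℤ) : (Pi.single vx k : Fin 3 → ℤ) vy = 0 := rfl

@[simp]
theorem single_vx_vz (k : ℤ) : (Pi.single vx k : Fin 3 → ℤ) vz = 0 := rfl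

@[simp]
theorem single_vy_vx (k : ℤ) : (Pi.single vy k : Fin 3 → ℤ) vx = 0 := rfl

@[simp]
theorem single_vy_vz (k : ℤ) : (Pi.single vy k : Fin 3 → ℤ) vz = 0 := rfl

@[simp]
theorem single_vz_vx (k : ℤ) : (Pi.single vz k : Fin 3 → ℤ) vx = 0 := rfl

@[simp]
theorem single_vz_vy (k : ℤ) : (Pi.single vz k : Fin 3 → ℤ) vy = 0 := rfl

theorem opL_apply (p : Poly m) :
    opL m p = skewOp vx vy p - (1 / 2 : ℂ) • innerD vz vz p := rfl

theorem opR_apply (p : Poly m) :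
    opR m p = skewOp vy vx p + (1 / 2 : ℂ) • innerMul vz vz p := rfl

theorem opE_apply (p : Poly m) :
    opE m p = euler vy p - euler vx p + euler vz p + ((m : ℂ) / 2) • p := rfl

theorem projL_apply (p : Poly m) : projL m p = p + opEInv m (opR m (opL m p)) := rfl

theorem mem_kerL_iff {α : ℂ} {p : Poly m} :
    p ∈ kerL m 1 α ↔ opL m p = 0 ∧ euler vx p + euler vy p = p ∧ opE m p = α • p := by
  simp [kerL, Submodule.mem_inf, LinearMap.mem_ker, and_assoc]

theorem mem_kerLx_iff {α : ℂ} {p : Poly m} :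
    p ∈ kerLx m α ↔ p ∈ kerL m 1 α ∧ euler vx p = p := by
  simp [kerLx, Submodule.mem_inf]

theorem degOf_of_mem_kerL {a : ℕ} {p : Poly m} (hp : p ∈ kerL m 1 ((m : ℂ) / 2 - 1 + a))
    {s : Fin 3 × Fin m →₀ ℕ} (hs : coeff s p ≠ 0) :
    degOf vx s + degOf vy s = 1 ∧ degOf vy s + degOf vz s + 1 = a + degOf vx s := by
  obtain ⟨-, h1, h2⟩ := mem_kerL_iff.1 hp
  have h1' := congrArg (coeff s) h1
  have h2' := congrArg (coeff s) h2
  rw [coeff_add, coeff_euler, coeff_euler, ← add_mul] at h1'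
  rw [coeff_opE, coeff_smul, smul_eq_mul] at h2'
  have h3 := mul_right_cancel₀ hs (h1'.trans (one_mul _).symm)
  have h4 := mul_right_cancel₀ hs h2'
  constructor
  · exact_mod_cast h3
  · have : (degOf vy s : ℂ) + degOf vz s + 1 = a + degOf vx s := by linear_combination h4
    exact_mod_cast this

theorem euler_vx_mem_homog_of_mem_kerL {a : ℕ} {p : Poly m}
    (hp : p ∈ kerL m 1 ((m : ℂ) / 2 - 1 + a)) :
    euler vx p ∈ homog m (Pi.single vz (a : ℤ) + Pi.single vx 1) := by
  refine mem_homog_iff.2 fun s hs => ?_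
  rw [coeff_euler] at hs
  obtain ⟨h1, h2⟩ := degOf_of_mem_kerL hp (right_ne_zero_of_mul hs)
  have h3 : degOf vx s ≠ 0 := by exact_mod_cast left_ne_zero_of_mul hs
  refine forall_vectorVar ?_ ?_ ?_ <;> simp <;> omega

theorem euler_vy_mem_homog_of_mem_kerL {a : ℕ} {p : Poly m}
    (hp : p ∈ kerL m 1 ((m : ℂ) / 2 - 1 + a)) :
    euler vy p ∈ homog m (Pi.single vz ((a : ℤ) - 2) + Pi.single vy 1) := by
  refine mem_homog_iff.2 fun s hs => ?_
  rw [coeff_euler] at hs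
  obtain ⟨h1, h2⟩ := degOf_of_mem_kerL hp (right_ne_zero_of_mul hs)
  have h3 : degOf vy s ≠ 0 := by exact_mod_cast left_ne_zero_of_mul hs
  refine forall_vectorVar ?_ ?_ ?_ <;> simp <;> omega

theorem skewOp_eq_zero_of_mem_homog {d : Fin 3 → ℤ} {p : Poly m} (hp : p ∈ homog m d)
    (u : Fin 3) {v : Fin 3} (hv : d v ≤ 0) : skewOp u v p = 0 := by
  rw [skewOp_apply]
  exact Finset.sum_eq_zero fun j _ => by rw [pderiv_eq_zero_of_mem_homog hp hv, mul_zero]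

/-- On elements of degree zero in `y` the operator `L` reduces to `-(1/2) Δ_z`. -/
theorem kerLx_eq_tensorSpace (a : ℕ) : kerLx m ((m : ℂ) / 2 - 1 + a) = tensorSpace m vx a := by
  ext p
  rw [mem_tensorSpace_iff (by decide), mem_kerLx_iff]
  constructor
  · rintro ⟨hp, hx⟩
    have h1 := euler_vx_mem_homog_of_mem_kerL hp
    rw [hx] at h1
    have h2 := (mem_kerL_iff.1 hp).1
    rw [opL_apply, skewOp_eq_zero_of_mem_homog h1 _ (by simp), zero_sub, neg_eq_zero,
      smul_eq_zero] at h2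
    exact ⟨h1, h2.resolve_left (by norm_num)⟩
  · rintro ⟨h1, h2⟩
    have hx := euler_of_mem_homog h1 vx
    have hy := euler_of_mem_homog h1 vy
    have hz := euler_of_mem_homog h1 vz
    simp at hx hy hz
    refine ⟨mem_kerL_iff.2 ⟨?_, by rw [hx, hy, add_zero], ?_⟩, hx⟩
    · rw [opL_apply, skewOp_eq_zero_of_mem_homog h1 _ (by simp), h2, smul_zero, sub_zero]
    · rw [opE_apply, hx, hy, hz]
      module

section

variable {k : ℤ} {q : Poly m}

theorem skewOp_mem_homog_of_mem_tensorSpace (hq : q ∈ tensorSpace m vy k) :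
    skewOp vx vy q ∈ homog m (Pi.single vz k + Pi.single vx 1) :=
  skewOp_mem_homog ((mem_tensorSpace_iff (by decide)).1 hq).1 vx vy (by abel)

theorem innerMul_skewOp_mem_homog (hq : q ∈ tensorSpace m vy k) :
    innerMul vz vz (skewOp vx vy q) ∈ homog m (Pi.single vz (k + 2) + Pi.single vx 1) :=
  innerMul_mem_homog (skewOp_mem_homog_of_mem_tensorSpace hq) vz vz (by
    rw [show k + 2 = k + 1 + 1 by ring, Pi.single_add, Pi.single_add]
    abel)

/-- The projector `Π_L` on `(1)_y ⊗ (k)_z`. -/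
theorem projL_of_mem_tensorSpace (hq : q ∈ tensorSpace m vy k) :
    projL m q = (1 + ((k : ℂ) + m / 2 - 1)⁻¹) • q +
      (((k : ℂ) + m / 2 - 1)⁻¹ * (1 / 2)) • innerMul vz vz (skewOp vx vy q) := by
  obtain ⟨h1, h2⟩ := (mem_tensorSpace_iff (by decide)).1 hq
  have hE1 := opEInv_of_mem_homog h1
  have hE2 := opEInv_of_mem_homog (innerMul_skewOp_mem_homog hq)
  have hy := euler_of_mem_homog h1 vy
  simp [euler] at hy
  have hy' : skewOp vy vx (skewOp vx vy q) = q := by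
    rw [skewOp_skewOp, if_pos rfl, if_pos rfl, hy, skewOp_eq_zero_of_mem_homog h1 vx (by simp),
      skewOp_eq_zero_of_mem_homog h1 vy (by simp), map_zero, sub_zero, add_zero]
  rw [projL_apply, opL_apply, h2, smul_zero, sub_zero, opR_apply, hy', map_add, map_smul, hE1, hE2]
  simp
  have e1 : (1 : ℂ) + k + m / 2 - 2 = k + m / 2 - 1 := by ring
  have e2 : (-1 : ℂ) + (k + 2) + m / 2 - 2 = k + m / 2 - 1 := by ring
  rw [e1, e2]
  module

/-- The projection of `q` has a nonzero multiple of `q` as its part of degree one in `y`. -/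
theorem euler_vy_projL (hq : q ∈ tensorSpace m vy k) :
    euler vy (projL m q) = (1 + ((k : ℂ) + m / 2 - 1)⁻¹) • q := by
  have h1 := euler_of_mem_homog ((mem_tensorSpace_iff (by decide)).1 hq).1 vy
  have h2 := euler_of_mem_homog (innerMul_skewOp_mem_homog hq) vy
  simp at h1 h2
  rw [projL_of_mem_tensorSpace hq, map_add, map_smul, map_smul, h1, h2, smul_zero, add_zero]

/-- The operator `𝓔 - 2` is invertible on the degrees that occur in `projL_of_mem_tensorSpace`. -/
theorem add_half_sub_ne_zero (hm : 3 ≤ m) (hk : 0 ≤ k) : (k : ℂ) + m / 2 - 1 ≠ 0 := by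
  intro h
  exact two_mul_add_sub_ne_zero hm hk (by linear_combination 2 * h)

theorem one_add_inv_ne_zero (hm : 3 ≤ m) (hk : 0 ≤ k) :
    1 + ((k : ℂ) + m / 2 - 1)⁻¹ ≠ 0 := by
  intro h
  have h1 := mul_inv_cancel₀ (add_half_sub_ne_zero hm hk)
  have h2 : 2 * (k : ℂ) + m = 0 := by
    linear_combination (2 : ℂ) * ((k : ℂ) + m / 2 - 1) * h - 2 * h1
  have h3 : 2 * k + m = 0 := by exact_mod_cast h2
  omega

theorem soInvariant_tensorSpace {u : Fin 3} (hu : u ≠ vz) (k : ℤ) :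
    SoInvariant (tensorSpace m u k) := by
  intro a b p hp
  obtain ⟨h1, h2⟩ := (mem_tensorSpace_iff hu).1 hp
  exact (mem_tensorSpace_iff hu).2 ⟨rot_mem_homog h1 a b, by rw [← rot_innerD, h2, map_zero]⟩

theorem soEmbedding_projL (hm : 3 ≤ m) (k : ℤ) :
    SoEmbedding (projL m) (tensorSpace m vy k) := by
  refine ⟨fun p hp h0 => ?_, fun a b p hp => ?_⟩
  · rcases lt_or_ge k 0 with hk | hk
    · rwa [tensorSpace_eq_bot (by decide) hk, Submodule.mem_bot] at hp
    · have h := euler_vy_projL hp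
      rw [h0, map_zero, eq_comm, smul_eq_zero] at h
      exact h.resolve_left (one_add_inv_ne_zero hm hk)
  · rw [projL_of_mem_tensorSpace hp,
      projL_of_mem_tensorSpace (soInvariant_tensorSpace (by decide) k a b p hp), map_add, map_smul,
      map_smul, rot_innerMul, rot_skewOp]

theorem projL_mem_kerL (hm : 3 ≤ m) {a : ℕ} (hq : q ∈ tensorSpace m vy ((a : ℤ) - 2)) :
    projL m q ∈ kerL m 1 ((m : ℂ) / 2 - 1 + a) := by
  rcases lt_or_ge ((a : ℤ) - 2) 0 with hk | hk
  · rw [tensorSpace_eq_bot (by decide) hk, Submodule.mem_bot] at hq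
    rw [hq, map_zero]
    exact Submodule.zero_mem _
  obtain ⟨h1, h2⟩ := (mem_tensorSpace_iff (by decide)).1 hq
  have hs := skewOp_mem_homog_of_mem_tensorSpace hq
  have hr := innerMul_skewOp_mem_homog hq
  have h0 := add_half_sub_ne_zero hm hk
  rw [projL_of_mem_tensorSpace hq]
  have hs0 : innerD vz vz (skewOp vx vy q) = 0 := by
    rw [innerD_skewOp, if_neg (by decide), if_neg (by decide), h2, map_zero, add_zero, add_zero]
  have hsz := euler_of_mem_homog hs vz
  simp [euler] at hsz
  have hqx := euler_of_mem_homog h1 vx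
  have hqy := euler_of_mem_homog h1 vy
  have hqz := euler_of_mem_homog h1 vz
  have hrx := euler_of_mem_homog hr vx
  have hry := euler_of_mem_homog hr vy
  have hrz := euler_of_mem_homog hr vz
  simp at hqx hqy hqz hrx hry hrz
  refine mem_kerL_iff.2 ⟨?_, ?_, ?_⟩
  · have hlap : innerD vz vz (innerMul vz vz (skewOp vx vy q)) =
        (2 * (m : ℂ) + 4 * (a - 2)) • skewOp vx vy q := by
      rw [innerD_innerMul]
      simp only [if_true, hs0, map_zero, hsz]
      module
    rw [opL_apply]
    simp only [map_add, map_smul, h2, hlap, skewOp_eq_zero_of_mem_homog hr vx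
      (show (Pi.single vz ((a : ℤ) - 2 + 2) + Pi.single vx 1 : Fin 3 → ℤ) vy ≤ 0 by simp)]
    have hb := mul_inv_cancel₀ h0
    push_cast at hb ⊢
    match_scalars
    linear_combination -hb
  · simp only [map_add, map_smul, hqx, hqy, hrx, hry]
    module
  · rw [opE_apply]
    simp only [map_add, map_smul, hqx, hqy, hrx, hry, hqz, hrz]
    module

/-- The part of degree one in `y` of an element of the kernel has harmonic coefficients, and
subtracting a multiple of its projection leaves an element of degree one in `x`. -/
theorem isDirectSum_kerL (hm : 3 ≤ m) (a : ℕ) :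
    IsDirectSum (kerL m 1 ((m : ℂ) / 2 - 1 + a)) ![kerLx m ((m : ℂ) / 2 - 1 + a),
      (tensorSpace m vy ((a : ℤ) - 2)).map (projL m)] := by
  refine isDirectSum_two (fun p hp => (mem_kerLx_iff.1 hp).1) ?_ ?_ ?_
  · rintro _ ⟨q, hq, rfl⟩
    exact projL_mem_kerL hm hq
  · rintro p hp _ ⟨q, hq, rfl⟩ hsum
    rw [SetLike.mem_coe] at hq
    suffices h : projL m q = 0 by
      rw [h, add_zero] at hsum
      exact ⟨hsum, h⟩
    rcases lt_or_ge ((a : ℤ) - 2) 0 with hk | hk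
    · rw [tensorSpace_eq_bot (by decide) hk, Submodule.mem_bot] at hq
      rw [hq, map_zero]
    · obtain ⟨hp1, hp2⟩ := mem_kerLx_iff.1 hp
      have hy := (mem_kerL_iff.1 hp1).2.1
      rw [hp2, add_eq_left] at hy
      have h := congrArg (euler vy) hsum
      rw [map_add, hy, euler_vy_projL hq, zero_add, map_zero, smul_eq_zero] at h
      rw [h.resolve_left (one_add_inv_ne_zero hm hk), map_zero]
  · intro p hp
    obtain ⟨h1, h2, -⟩ := mem_kerL_iff.1 hp
    have hpx := euler_vx_mem_homog_of_mem_kerL hp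
    have hpy := euler_vy_mem_homog_of_mem_kerL hp
    have hyT : euler vy p ∈ tensorSpace m vy ((a : ℤ) - 2) := by
      refine (mem_tensorSpace_iff (by decide)).2 ⟨hpy, ?_⟩
      have hsx := skewOp_eq_zero_of_mem_homog hpx vx (v := vy) (by simp)
      have hsy := skewOp_mem_homog (d' := Pi.single vz ((a : ℤ) - 2) + Pi.single vx 1) hpy vx vy
        (by abel)
      have hdx := innerD_mem_homog (d' := Pi.single vz ((a : ℤ) - 2) + Pi.single vx 1) hpx vz vz
        (by funext w; simp only [Pi.add_apply, Pi.single_apply]; split_ifs <;> omega)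
      have hdy := innerD_mem_homog (d' := Pi.single vz ((a : ℤ) - 4) + Pi.single vy 1) hpy vz vz
        (by funext w; simp only [Pi.add_apply, Pi.single_apply]; split_ifs <;> omega)
      rw [opL_apply, ← h2, map_add, map_add, hsx, zero_add] at h1
      have h := congrArg (euler vy) h1
      rw [map_sub, map_smul, map_add, euler_of_mem_homog hsy, euler_of_mem_homog hdx,
        euler_of_mem_homog hdy] at h
      simpa using h
    rcases lt_or_ge ((a : ℤ) - 2) 0 with hk | hk
    · rw [tensorSpace_eq_bot (by decide) hk, Submodule.mem_bot] at hyT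
      rw [hyT, add_zero] at h2
      exact ⟨p, mem_kerLx_iff.2 ⟨hp, h2⟩, 0, Submodule.zero_mem _, (add_zero p).symm⟩
    · have hq := Submodule.smul_mem _ (1 + ((((a : ℤ) - 2 : ℤ) : ℂ) + m / 2 - 1)⁻¹)⁻¹ hyT
      have hr := Submodule.sub_mem _ hp (projL_mem_kerL hm hq)
      refine ⟨_, mem_kerLx_iff.2 ⟨hr, ?_⟩, _, Submodule.mem_map_of_mem hq, by abel⟩
      have h := (mem_kerL_iff.1 hr).2.1
      rwa [map_sub (euler vy), euler_vy_projL hq, smul_smul,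
        mul_inv_cancel₀ (one_add_inv_ne_zero hm hk), one_smul, sub_self, add_zero] at h

end

end SympMonogenic

theorem mainTheorem3 (m : ℕ) (hm : 6 ≤ m) (a : ℕ) (α : ℂ) (hα : α = (m : ℂ) / 2 - 1 + a) :
    -- the two kinds of contributions to the kernel
    IsDirectSum (kerL m 1 α)
      ![kerLx m α, (tensorSpace m vy ((a : ℤ) - 2)).map (projL m)] ∧
    -- degree one in `x`
    (kerLx m α = tensorSpace m vx a ∧
      IsDirectSum (kerLx m α)
        ![simpHarm m vx a 1, (harm m ((a : ℤ) + 1)).map (opS m vx vz),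
          (harm m ((a : ℤ) - 1)).map (opC m vx vz)] ∧
      SoEmbedding (opS m vx vz) (harm m ((a : ℤ) + 1)) ∧
      SoEmbedding (opC m vx vz) (harm m ((a : ℤ) - 1)) ∧
      (if 1 ≤ a then SoIrreducible (simpHarm m vx a 1) else simpHarm m vx a 1 = ⊥) ∧
      SoIrreducible ((harm m ((a : ℤ) + 1)).map (opS m vx vz)) ∧
      (if 1 ≤ a then SoIrreducible ((harm m ((a : ℤ) - 1)).map (opC m vx vz))
        else (harm m ((a : ℤ) - 1)).map (opC m vx vz) = ⊥)) ∧
    -- degree one in `y`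
    (IsDirectSum (tensorSpace m vy ((a : ℤ) - 2))
        ![simpHarm m vy ((a : ℤ) - 2) 1, (harm m ((a : ℤ) - 1)).map (opS m vy vz),
          (harm m ((a : ℤ) - 3)).map (opC m vy vz)] ∧
      IsDirectSum ((tensorSpace m vy ((a : ℤ) - 2)).map (projL m))
        ![(simpHarm m vy ((a : ℤ) - 2) 1).map (projL m),
          ((harm m ((a : ℤ) - 1)).map (opS m vy vz)).map (projL m),
          ((harm m ((a : ℤ) - 3)).map (opC m vy vz)).map (projL m)] ∧
      SoEmbedding (projL m) (tensorSpace m vy ((a : ℤ) - 2)) ∧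
      (2 ≤ a → SoEmbedding (opS m vy vz) (harm m ((a : ℤ) - 1))) ∧
      SoEmbedding (opC m vy vz) (harm m ((a : ℤ) - 3)) ∧
      (if 3 ≤ a then SoIrreducible ((simpHarm m vy ((a : ℤ) - 2) 1).map (projL m))
        else (simpHarm m vy ((a : ℤ) - 2) 1).map (projL m) = ⊥) ∧
      (if 2 ≤ a then SoIrreducible (((harm m ((a : ℤ) - 1)).map (opS m vy vz)).map (projL m))
        else ((harm m ((a : ℤ) - 1)).map (opS m vy vz)).map (projL m) = ⊥) ∧
      (if 3 ≤ a then SoIrreducible (((harm m ((a : ℤ) - 3)).map (opC m vy vz)).map (projL m))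
        else ((harm m ((a : ℤ) - 3)).map (opC m vy vz)).map (projL m) = ⊥)) := by
  subst hα
  have hxz : vx ≠ vz := by decide
  have hyz : vy ≠ vz := by decide
  have hm3 : 3 ≤ m := by omega
  have e1 : (a : ℤ) - 2 + 1 = a - 1 := by ring
  have e2 : (a : ℤ) - 2 - 1 = a - 3 := by ring
  have hdec := isDirectSum_tensorSpace hm3 hyz ((a : ℤ) - 2)
  rw [e1, e2] at hdec
  have hproj := soEmbedding_projL hm3 ((a : ℤ) - 2)
  have hS := map_opS_le_tensorSpace (m := m) hyz ((a : ℤ) - 2)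
  have hC := map_opC_le_tensorSpace hm3 hyz ((a : ℤ) - 2)
  rw [e1] at hS
  rw [e2] at hC
  -- `Π_L` is injective on each invariant subspace of `(1)_y ⊗ (a - 2)_z`
  have hsub : ∀ W ≤ tensorSpace m vy ((a : ℤ) - 2), SoEmbedding (projL m) W := fun W hW =>
    ⟨fun p hp => hproj.1 p (hW hp), fun b c p hp => hproj.2 b c p (hW hp)⟩
  have hbot : ∀ W ≤ tensorSpace m vy ((a : ℤ) - 2), a < 2 → W.map (projL m) = ⊥ := by
    intro W hW ha
    rw [tensorSpace_eq_bot hyz (by omega), le_bot_iff] at hW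
    rw [hW, Submodule.map_bot]
  refine ⟨isDirectSum_kerL hm3 a, ⟨kerLx_eq_tensorSpace a, ?_, soEmbedding_opS hxz (by omega),
    soEmbedding_opC hm3 hxz _, ?_, ?_, ?_⟩, hdec, ?_, hproj, fun _ =>
    soEmbedding_opS hyz (by omega), soEmbedding_opC hm3 hyz _, ?_, ?_, ?_⟩
  · rw [kerLx_eq_tensorSpace]
    exact isDirectSum_tensorSpace hm3 hxz a
  · split_ifs with ha
    · obtain ⟨k, rfl⟩ := Nat.exists_eq_succ_of_ne_zero (by omega : a ≠ 0)
      exact soIrreducible_simpHarm (by omega) hxz k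
    · exact simpHarm_eq_bot hxz (by omega)
  · exact (soIrreducible_harm hm3 (a + 1)).map (soEmbedding_opS hxz (by omega))
  · split_ifs with ha
    · obtain ⟨k, hk⟩ := Int.eq_ofNat_of_zero_le (by omega : 0 ≤ (a : ℤ) - 1)
      rw [hk]
      exact (soIrreducible_harm hm3 k).map (soEmbedding_opC hm3 hxz k)
    · rw [harm_eq_bot (by omega), Submodule.map_bot]
  · have h := hdec.map hproj.1
    convert h using 1
    funext i
    fin_cases i <;> rfl
  · split_ifs with ha
    · obtain ⟨k, hk⟩ := Int.eq_ofNat_of_zero_le (by omega : 0 ≤ (a : ℤ) - 3)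
      have h := soIrreducible_simpHarm (m := m) (by omega) hyz k
      rw [show ((k + 1 : ℕ) : ℤ) = (a : ℤ) - 2 by omega] at h
      exact h.map (hsub _ (simpHarm_le_tensorSpace hyz _))
    · rw [simpHarm_eq_bot hyz (by omega), Submodule.map_bot]
  · split_ifs with ha
    · obtain ⟨k, hk⟩ := Int.eq_ofNat_of_zero_le (by omega : 0 ≤ (a : ℤ) - 1)
      refine SoIrreducible.map ?_ (hsub _ hS)
      rw [hk]
      exact (soIrreducible_harm hm3 k).map (soEmbedding_opS hyz (by omega))
    · exact hbot _ hS (by omega)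
  · split_ifs with ha
    · obtain ⟨k, hk⟩ := Int.eq_ofNat_of_zero_le (by omega : 0 ≤ (a : ℤ) - 3)
      refine SoIrreducible.map ?_ (hsub _ hC)
      rw [hk]
      exact (soIrreducible_harm hm3 k).map (soEmbedding_opC hm3 hyz k)
    · rw [harm_eq_bot (by omega), Submodule.map_bot, Submodule.map_bot]
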